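/- Let $0<L<L_0$ and let $\alpha:[-L_0,L_0]\to\mathbb R$ be continuous. For $T>0$, let $\mathscr R_L(T)$ be the set of states $u(T,\cdot)$ on $(-L,L)$, where $u$ is the (complex-valued, transposition) solution of $$\partial_t u-\partial_{xx}u=0 \text{ in }(0,T)\times(-L,L),\quad u(t,-L)=v_-(t),\ u(t,L)=v_+(t)\text{ in }(0,T),\quad u(0,\cdot)=0,$$ for some controls $v_-,v_+\in L^2(0,T;\mathbb C)$. For $h\in L^2(-L_0,L_0;\mathbb C)$ define $$g(t,x)=\frac1{t^{3/2}}\exp\Big(\frac{x^2-L_0^2}{4t}+i\,\frac{\alpha(x)}{4t}\Big)h(x),\qquad (t,x)\in(0,\infty)\times(-L_0,L_0).$$ Then the state $$w_0(x)=\int_0^\infty\!\!\int_{-L_0}^{L_0}\frac1{\sqrt{4\pi t}}\exp\Big(-\frac{(x-\tilde x)^2}{4t}\Big)g(t,\tilde x)\,d\tilde x\,dt,\qquad x\in(-L,L),$$ is well defined (the double integral converges absolutely for every $x\in(-L,L)$), belongs to $L^2(-L,L)$, and belongs to $\mathscr R_L(T)$ for every $T>0$. Moreover, for every $x\in(-L,L)$,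 $$w_0(x)=\frac2{\sqrt\pi}\int_{-L_0}^{L_0}\frac{h(\tilde x)}{(x-\tilde x)^2+L_0^2-\tilde x^2-i\,\alpha(\tilde x)}\,d\tilde x ,$$ the integral being absolutely convergent. Consequently, for the operator $K_\alpha:L^2(-L_0,L_0)\to L^2(-L,L)$ given by the absolutely convergent integral $$K_\alpha(h)(x)=\frac2{\sqrt\pi}\int_{-L_0}^{L_0}\frac{h(\tilde x)}{(x-\tilde x)^2+L_0^2-\tilde x^2+i\,\alpha(\tilde x)}\,d\tilde x,\qquad x\in(-L,L),$$ one has $\mathrm{Range}(K_\alpha)\subset\mathscr R_L(T)$ for every $T>0$. -/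

import Mathlib

open MeasureTheory Set
open scoped ContDiff

noncomputable section

namespace HeatReach

/-- `u` solves `∂ₜu - ∂ₓₓu = 0` in `(0,T) × (-L,L)`, `u(t,-L) = vm t`, `u(t,L) = vp t`, `u(0,·) = 0`,
with complex-valued `L²` boundary data, in the sense of transposition: `u ∈ L²((0,T) × (-L,L))` and,
for every time `τ ∈ [0,T]` and every smooth `φ` vanishing on the lateral boundary,
`∫ u(τ) φ(τ) dx = ∫₀^τ ∫ u (∂ₜφ + ∂ₓₓφ) dx dt + ∫₀^τ (vm ∂ₓφ(t,-L) - vp ∂ₓφ(t,L)) dt`.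
For `τ = 0` this is the initial condition. For a general `L²` boundary datum `u(τ)` need not be
integrable up to `x = ±L`, but its product with such a `φ(τ)` is. -/
structure IsSolution (L T : ℝ) (vm vp : ℝ → ℂ) (u : ℝ → ℝ → ℂ) : Prop where
  memLp : MemLp (Function.uncurry u) 2 (volume.restrict (Ioo 0 T ×ˢ Ioo (-L) L))
  weak : ∀ τ ∈ Icc (0 : ℝ) T, ∀ φ : ℝ → ℝ → ℂ, ContDiff ℝ ∞ (Function.uncurry φ) →
    (∀ t ∈ Icc (0 : ℝ) τ, φ t (-L) = 0 ∧ φ t L = 0) →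
    IntegrableOn (fun x => u τ x * φ τ x) (Ioo (-L) L) ∧
    ∫ x in Ioo (-L) L, u τ x * φ τ x =
      (∫ p in Ioo 0 τ ×ˢ Ioo (-L) L,
        u p.1 p.2 * (deriv (fun t => φ t p.2) p.1 + deriv (deriv (φ p.1)) p.2)) +
      ∫ t in Ioo 0 τ, (vm t * deriv (φ t) (-L) - vp t * deriv (φ t) L)

/-- The set of states `u(T)` reached at time `T` (functions on `(-L,L)`, up to null sets) by
solutions with controls in `L²(0,T)`. -/
def reachableSet (L T : ℝ) : Set (ℝ → ℂ) :=
  {w | ∃ vm vp : ℝ → ℂ, ∃ u : ℝ → ℝ → ℂ,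
    MemLp vm 2 (volume.restrict (Ioo 0 T)) ∧ MemLp vp 2 (volume.restrict (Ioo 0 T)) ∧
    IsSolution L T vm vp u ∧ u T =ᵐ[volume.restrict (Ioo (-L) L)] w}

/-- The source `g(t,x) = t^{-3/2} exp((x² - L₀²)/4t + i α(x)/4t) h(x)`. -/
def source (L₀ : ℝ) (α : ℝ → ℝ) (h : ℝ → ℂ) (t x : ℝ) : ℂ :=
  1 / ((t ^ (3 / 2 : ℝ) : ℝ) : ℂ) *
    Complex.exp (((x ^ 2 - L₀ ^ 2) / (4 * t) : ℝ) + Complex.I * ((α x / (4 * t) : ℝ) : ℂ)) * h x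

/-- The heat kernel of the line. -/
def heatKernel (t x : ℝ) : ℝ :=
  1 / Real.sqrt (4 * Real.pi * t) * Real.exp (-x ^ 2 / (4 * t))

/-- `w₀(x) = ∫∫ heatKernel t (x - y) g(t,y)` over `(t,y) ∈ (0,∞) × (-L₀,L₀)`. -/
def w₀ (L₀ : ℝ) (α : ℝ → ℝ) (h : ℝ → ℂ) (x : ℝ) : ℂ :=
  ∫ p in Ioi (0 : ℝ) ×ˢ Ioo (-L₀) L₀, (heatKernel p.1 (x - p.2) : ℂ) * source L₀ α h p.1 p.2

/-- The integrand `h(y) / ((x - y)² + L₀² - y² + i α(y))` of `K_α`. -/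
def kernelIntegrand (L₀ : ℝ) (α : ℝ → ℝ) (h : ℝ → ℂ) (x y : ℝ) : ℂ :=
  h y / ((((x - y) ^ 2 + L₀ ^ 2 - y ^ 2 : ℝ) : ℂ) + Complex.I * (α y : ℂ))

/-- `K_α(h)(x) = (2/√π) ∫_{-L₀}^{L₀} h(y) / ((x - y)² + L₀² - y² + i α(y)) dy`. -/
def K (L₀ : ℝ) (α : ℝ → ℝ) (h : ℝ → ℂ) (x : ℝ) : ℂ :=
  ((2 / Real.sqrt Real.pi : ℝ) : ℂ) * ∫ y in Ioo (-L₀) L₀, kernelIntegrand L₀ α h x y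

/-- The range of `K_α` on `L²(-L₀,L₀)`. -/
def rangeK (L₀ : ℝ) (α : ℝ → ℝ) : Set (ℝ → ℂ) :=
  {k | ∃ h : ℝ → ℂ, MemLp h 2 (volume.restrict (Ioo (-L₀) L₀)) ∧ k = K L₀ α h}

end HeatReach

end

/-!
Integrating out `t` gives `w₀(x) = (2/√π) ∫ h(y) / D(x, y) dy` with
`D(x, y) = (x - y)² + L₀² - y² - iα(y)`. For complex `x` and `|y| < L₀` the real part of `D` is at
least `(L₀ - |Re x| - |Im x|)²`, so `w₀`, and likewise `K_α h`, extends holomorphically to the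
diamond `|Re ζ| + |Im ζ| < L₀`. Every function holomorphic on such a diamond is reachable.

Indeed, by Cauchy's formula on a smaller diamond it is a superposition of poles `1 / (x - p)`, where
`p` runs through four segments of slope `±1`, each ending at a vertex `z = ±R` outside `[-L, L]`.
With `c = -(p - z)²`, which is purely imaginary, a pole is the sum over all times of what monopoles
and dipoles at `z` of intensity `t ^ (-a) exp (-c / 4t)` emit. Sources switched on during `(0, T)`
only give a solution on `[-L, L]` that starts from `0`; what is missing is an entire function that
grows at most like `exp (B |ζ|²)`, and such a function is reachable: it is the value at time `T` of
a power series solution in `x` whose coefficients are the time derivatives of two Gevrey functions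
with prescribed jets at `T` that vanish near time `0`.
-/

noncomputable section

namespace HeatReach

theorem hasDerivAt_integral_of_isOpen {Ω : Type*} [MeasurableSpace Ω] {ν : Measure Ω}
    {F F' : Ω → ℝ → ℂ} {g g' : Ω → ℝ} {S : Set ℝ} (hS : IsOpen S)
    (hF : ∀ x ∈ S, AEStronglyMeasurable (fun θ => F θ x) ν)
    (hF' : ∀ x ∈ S, AEStronglyMeasurable (fun θ => F' θ x) ν) (hg : Integrable g ν)
    (hg' : Integrable g' ν) (hFg : ∀ᵐ θ ∂ν, ∀ x ∈ S, ‖F θ x‖ ≤ g θ)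
    (hFg' : ∀ᵐ θ ∂ν, ∀ x ∈ S, ‖F' θ x‖ ≤ g' θ)
    (hder : ∀ᵐ θ ∂ν, ∀ x ∈ S, HasDerivAt (F θ) (F' θ x) x) {x : ℝ} (hx : x ∈ S) :
    HasDerivAt (fun y => ∫ θ, F θ y ∂ν) (∫ θ, F' θ x ∂ν) x :=
  (hasDerivAt_integral_of_dominated_loc_of_deriv_le (F := fun y θ => F θ y)
    (F' := fun y θ => F' θ y) (hS.mem_nhds hx) (Filter.eventually_of_mem (hS.mem_nhds hx) hF)
    (hg.mono' (hF x hx) (hFg.mono fun _ h => h x hx)) (hF' x hx) hFg' hg' hder).2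

theorem memLp_of_continuousOn_of_isCompact {X : Type*} [TopologicalSpace X] [MeasurableSpace X]
    [OpensMeasurableSpace X] [T2Space X] {μ : Measure X}
    [IsFiniteMeasureOnCompacts μ] {K : Set X} {f : X → ℂ} (hf : ContinuousOn f K)
    (hK : IsCompact K) (p : ENNReal) : MemLp f p (μ.restrict K) := by
  obtain ⟨C, hC⟩ := hK.exists_bound_of_continuousOn hf
  have : IsFiniteMeasure (μ.restrict K) := ⟨by simpa using hK.measure_lt_top⟩
  exact .of_bound (hf.aestronglyMeasurable_of_isCompact hK hK.measurableSet) C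
    ((ae_restrict_iff' hK.measurableSet).2 (.of_forall hC))

theorem integrableOn_Ioo_prod_Ioo_of_continuousOn {a b c d : ℝ} {f : ℝ × ℝ → ℂ}
    (hf : ContinuousOn f (Icc a b ×ˢ Icc c d)) : IntegrableOn f (Ioo a b ×ˢ Ioo c d) :=
  (hf.integrableOn_compact (isCompact_Icc.prod isCompact_Icc)).mono_set
    (prod_mono Ioo_subset_Icc_self Ioo_subset_Icc_self)

/-- A solution of the heat equation on `(0,T) × (-L,L)` that vanishes at time `0`, together with its
derivatives `ut = ∂ₜu` and `ux = ∂ₓu`, all three being continuous up to the boundary. The derivative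
of `ux` in `x` is `ut`, which is the heat equation. -/
structure IsClassicalSolution (L T : ℝ) (u ut ux : ℝ → ℝ → ℂ) : Prop where
  continuousOn : ContinuousOn (Function.uncurry u) (Icc 0 T ×ˢ Icc (-L) L)
  continuousOn_dt : ContinuousOn (Function.uncurry ut) (Icc 0 T ×ˢ Icc (-L) L)
  continuousOn_dx : ContinuousOn (Function.uncurry ux) (Icc 0 T ×ˢ Icc (-L) L)
  hasDerivAt_dt : ∀ s ∈ Ioo 0 T, ∀ x ∈ Ioo (-L) L, HasDerivAt (fun r => u r x) (ut s x) s
  hasDerivAt_dx : ∀ s ∈ Ioo 0 T, ∀ x ∈ Ioo (-L) L, HasDerivAt (u s) (ux s x) x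
  hasDerivAt_dxx : ∀ s ∈ Ioo 0 T, ∀ x ∈ Ioo (-L) L, HasDerivAt (ux s) (ut s x) x
  initial : ∀ x ∈ Icc (-L) L, u 0 x = 0

theorem contDiff_fderiv_apply {f : ℝ × ℝ → ℂ} (hf : ContDiff ℝ ∞ f) (v : ℝ × ℝ) :
    ContDiff ℝ ∞ fun p => fderiv ℝ f p v :=
  (hf.fderiv_right (m := ∞) (by simp)).clm_apply contDiff_const

theorem hasDerivAt_partial_fst {f : ℝ × ℝ → ℂ} (hf : ContDiff ℝ ∞ f) (t x : ℝ) :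
    HasDerivAt (fun s => f (s, x)) (fderiv ℝ f (t, x) (1, 0)) t :=
  (hf.differentiable (by simp) (t, x)).hasFDerivAt.comp_hasDerivAt t
    ((hasDerivAt_id t).prodMk (hasDerivAt_const t x))

theorem hasDerivAt_partial_snd {f : ℝ × ℝ → ℂ} (hf : ContDiff ℝ ∞ f) (t x : ℝ) :
    HasDerivAt (fun y => f (t, y)) (fderiv ℝ f (t, x) (0, 1)) x :=
  (hf.differentiable (by simp) (t, x)).hasFDerivAt.comp_hasDerivAt x
    ((hasDerivAt_const x t).prodMk (hasDerivAt_id x))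

theorem exists_partial_derivs {φ : ℝ → ℝ → ℂ} (hφ : ContDiff ℝ ∞ (Function.uncurry φ)) :
    ∃ φt φx φxx : ℝ × ℝ → ℂ, Continuous φt ∧ Continuous φx ∧ Continuous φxx ∧
      (∀ t x, HasDerivAt (fun s => φ s x) (φt (t, x)) t) ∧
      (∀ t x, HasDerivAt (φ t) (φx (t, x)) x) ∧
      (∀ t x, HasDerivAt (fun y => φx (t, y)) (φxx (t, x)) x) :=
  have hφx := contDiff_fderiv_apply hφ (0, 1)
  ⟨_, _, _, (contDiff_fderiv_apply hφ (1, 0)).continuous, hφx.continuous,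
    (contDiff_fderiv_apply hφx (0, 1)).continuous, hasDerivAt_partial_fst hφ,
    hasDerivAt_partial_snd hφ, hasDerivAt_partial_snd hφx⟩

namespace IsClassicalSolution

variable {L T : ℝ} {u ut ux v vt vx : ℝ → ℝ → ℂ}

theorem zero : IsClassicalSolution L T 0 0 0 where
  continuousOn := continuousOn_const
  continuousOn_dt := continuousOn_const
  continuousOn_dx := continuousOn_const
  hasDerivAt_dt s _ _ _ := hasDerivAt_const s 0
  hasDerivAt_dx _ _ x _ := hasDerivAt_const x 0
  hasDerivAt_dxx _ _ x _ := hasDerivAt_const x 0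
  initial _ _ := rfl

theorem add (hu : IsClassicalSolution L T u ut ux) (hv : IsClassicalSolution L T v vt vx) :
    IsClassicalSolution L T (u + v) (ut + vt) (ux + vx) where
  continuousOn := hu.continuousOn.add hv.continuousOn
  continuousOn_dt := hu.continuousOn_dt.add hv.continuousOn_dt
  continuousOn_dx := hu.continuousOn_dx.add hv.continuousOn_dx
  hasDerivAt_dt s hs x hx := (hu.hasDerivAt_dt s hs x hx).add (hv.hasDerivAt_dt s hs x hx)
  hasDerivAt_dx s hs x hx := (hu.hasDerivAt_dx s hs x hx).add (hv.hasDerivAt_dx s hs x hx)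
  hasDerivAt_dxx s hs x hx := (hu.hasDerivAt_dxx s hs x hx).add (hv.hasDerivAt_dxx s hs x hx)
  initial x hx := by simp [hu.initial x hx, hv.initial x hx]

section Integral

variable {Ω : Type*} [MeasurableSpace Ω] {ν : Measure Ω} {U Ut Ux : Ω → ℝ → ℝ → ℂ} {g : Ω → ℝ}

theorem integral (hU : ∀ s x, AEStronglyMeasurable (fun θ => U θ s x) ν)
    (hUt : ∀ s x, AEStronglyMeasurable (fun θ => Ut θ s x) ν)
    (hUx : ∀ s x, AEStronglyMeasurable (fun θ => Ux θ s x) ν) (hg : Integrable g ν)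
    (hbound : ∀ᵐ θ ∂ν, ∀ s ∈ Icc 0 T, ∀ x ∈ Icc (-L) L,
      ‖U θ s x‖ ≤ g θ ∧ ‖Ut θ s x‖ ≤ g θ ∧ ‖Ux θ s x‖ ≤ g θ)
    (hsol : ∀ᵐ θ ∂ν, IsClassicalSolution L T (U θ) (Ut θ) (Ux θ)) :
    IsClassicalSolution L T (fun s x => ∫ θ, U θ s x ∂ν) (fun s x => ∫ θ, Ut θ s x ∂ν)
      (fun s x => ∫ θ, Ux θ s x ∂ν) where
  continuousOn := continuousOn_of_dominated (fun p _ => hU p.1 p.2)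
    (fun p hp => hbound.mono fun _ h => (h p.1 hp.1 p.2 hp.2).1) hg
    (hsol.mono fun _ h => h.continuousOn)
  continuousOn_dt := continuousOn_of_dominated (fun p _ => hUt p.1 p.2)
    (fun p hp => hbound.mono fun _ h => (h p.1 hp.1 p.2 hp.2).2.1) hg
    (hsol.mono fun _ h => h.continuousOn_dt)
  continuousOn_dx := continuousOn_of_dominated (fun p _ => hUx p.1 p.2)
    (fun p hp => hbound.mono fun _ h => (h p.1 hp.1 p.2 hp.2).2.2) hg
    (hsol.mono fun _ h => h.continuousOn_dx)
  hasDerivAt_dt s hs x hx := by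
    have hxI := Ioo_subset_Icc_self hx
    refine hasDerivAt_integral_of_isOpen (F := fun θ r => U θ r x) (F' := fun θ r => Ut θ r x)
      isOpen_Ioo (fun r _ => hU r x) (fun r _ => hUt r x) hg hg ?_ ?_
      (hsol.mono fun _ h r hr => h.hasDerivAt_dt r hr x hx) hs
    · exact hbound.mono fun _ h r hr => (h r (Ioo_subset_Icc_self hr) x hxI).1
    · exact hbound.mono fun _ h r hr => (h r (Ioo_subset_Icc_self hr) x hxI).2.1
  hasDerivAt_dx s hs x hx := by
    have hsI := Ioo_subset_Icc_self hs
    refine hasDerivAt_integral_of_isOpen isOpen_Ioo (fun y _ => hU s y) (fun y _ => hUx s y) hg hg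
      ?_ ?_ (hsol.mono fun _ h => h.hasDerivAt_dx s hs) hx
    · exact hbound.mono fun _ h y hy => (h s hsI y (Ioo_subset_Icc_self hy)).1
    · exact hbound.mono fun _ h y hy => (h s hsI y (Ioo_subset_Icc_self hy)).2.2
  hasDerivAt_dxx s hs x hx := by
    have hsI := Ioo_subset_Icc_self hs
    refine hasDerivAt_integral_of_isOpen isOpen_Ioo (fun y _ => hUx s y) (fun y _ => hUt s y) hg hg
      ?_ ?_ (hsol.mono fun _ h => h.hasDerivAt_dxx s hs) hx
    · exact hbound.mono fun _ h y hy => (h s hsI y (Ioo_subset_Icc_self hy)).2.2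
    · exact hbound.mono fun _ h y hy => (h s hsI y (Ioo_subset_Icc_self hy)).2.1
  initial x hx := integral_eq_zero_of_ae (hsol.mono fun _ h => h.initial x hx)

end Integral

section Transposition

variable {τ : ℝ} {φ : ℝ → ℝ → ℂ} {φt φx φxx : ℝ × ℝ → ℂ}

theorem setIntegral_dt_mul (hu : IsClassicalSolution L T u ut ux) (hτ : τ ∈ Icc 0 T)
    (hφ : Continuous (Function.uncurry φ)) (hφt : Continuous φt)
    (hdt : ∀ t x, HasDerivAt (fun s => φ s x) (φt (t, x)) t) :
    ∫ p in Ioo 0 τ ×ˢ Ioo (-L) L, (ut p.1 p.2 * φ p.1 p.2 + u p.1 p.2 * φt p) =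
      ∫ x in Ioo (-L) L, u τ x * φ τ x := by
  have hsub : Icc 0 τ ×ˢ Icc (-L) L ⊆ Icc 0 T ×ˢ Icc (-L) L :=
    prod_mono_left (Icc_subset_Icc_right hτ.2)
  have hcont : ContinuousOn (fun p : ℝ × ℝ => ut p.1 p.2 * φ p.1 p.2 + u p.1 p.2 * φt p)
      (Icc 0 τ ×ˢ Icc (-L) L) :=
    ((hu.continuousOn_dt.mono hsub).mul hφ.continuousOn).add
      ((hu.continuousOn.mono hsub).mul hφt.continuousOn)
  have hint := integrableOn_Ioo_prod_Ioo_of_continuousOn hcont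
  rw [IntegrableOn, Measure.volume_eq_prod, ← Measure.prod_restrict] at hint
  rw [Measure.volume_eq_prod, ← Measure.prod_restrict, integral_prod_symm _ hint]
  refine setIntegral_congr_fun measurableSet_Ioo fun x hx => ?_
  have hmaps : MapsTo (fun s : ℝ => (s, x)) (Icc 0 τ) (Icc 0 τ ×ˢ Icc (-L) L) :=
    fun s hs => ⟨hs, Ioo_subset_Icc_self hx⟩
  have hpair : Continuous fun s : ℝ => (s, x) := by fun_prop
  have hftc := intervalIntegral.integral_eq_sub_of_hasDerivAt_of_le hτ.1
    (((hu.continuousOn.mono hsub).mul hφ.continuousOn).comp hpair.continuousOn hmaps)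
    (fun s hs => (hu.hasDerivAt_dt s ⟨hs.1, hs.2.trans_le hτ.2⟩ x hx).mul (hdt s x))
    ((hcont.comp hpair.continuousOn hmaps).intervalIntegrable_of_Icc hτ.1)
  rw [intervalIntegral.integral_of_le hτ.1, integral_Ioc_eq_integral_Ioo] at hftc
  simpa [hu.initial x (Ioo_subset_Icc_self hx)] using hftc

theorem setIntegral_mul_dxx_sub (hL : 0 < L) (hu : IsClassicalSolution L T u ut ux)
    (hτ : τ ∈ Icc 0 T) (hφ : Continuous (Function.uncurry φ)) (hφx : Continuous φx)
    (hφxx : Continuous φxx) (hdx : ∀ t x, HasDerivAt (φ t) (φx (t, x)) x)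
    (hdxx : ∀ t x, HasDerivAt (fun y => φx (t, y)) (φxx (t, x)) x)
    (hb : ∀ t ∈ Icc (0 : ℝ) τ, φ t (-L) = 0 ∧ φ t L = 0) :
    ∫ p in Ioo 0 τ ×ˢ Ioo (-L) L, (u p.1 p.2 * φxx p - ut p.1 p.2 * φ p.1 p.2) =
      ∫ t in Ioo 0 τ, (u t L * φx (t, L) - u t (-L) * φx (t, -L)) := by
  have hLL : -L ≤ L := by linarith
  have hsub : Icc 0 τ ×ˢ Icc (-L) L ⊆ Icc 0 T ×ˢ Icc (-L) L :=
    prod_mono_left (Icc_subset_Icc_right hτ.2)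
  have hcont : ContinuousOn (fun p : ℝ × ℝ => u p.1 p.2 * φxx p - ut p.1 p.2 * φ p.1 p.2)
      (Icc 0 τ ×ˢ Icc (-L) L) :=
    ((hu.continuousOn.mono hsub).mul hφxx.continuousOn).sub
      ((hu.continuousOn_dt.mono hsub).mul hφ.continuousOn)
  have hint := integrableOn_Ioo_prod_Ioo_of_continuousOn hcont
  rw [Measure.volume_eq_prod, setIntegral_prod _ (by rwa [← Measure.volume_eq_prod])]
  refine setIntegral_congr_fun measurableSet_Ioo fun s hs => ?_
  have hsI : s ∈ Icc 0 τ := Ioo_subset_Icc_self hs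
  have hmaps : MapsTo (fun x : ℝ => (s, x)) (Icc (-L) L) (Icc 0 τ ×ˢ Icc (-L) L) :=
    fun x hx => ⟨hsI, hx⟩
  have hpair : Continuous fun x : ℝ => (s, x) := by fun_prop
  have hprimitive : ContinuousOn (fun p : ℝ × ℝ => u p.1 p.2 * φx p - ux p.1 p.2 * φ p.1 p.2)
      (Icc 0 τ ×ˢ Icc (-L) L) :=
    ((hu.continuousOn.mono hsub).mul hφx.continuousOn).sub
      ((hu.continuousOn_dx.mono hsub).mul hφ.continuousOn)
  have hder : ∀ x ∈ Ioo (-L) L, HasDerivAt (fun x => u s x * φx (s, x) - ux s x * φ s x)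
      (u s x * φxx (s, x) - ut s x * φ s x) x := fun x hx => by
    have hs' : s ∈ Ioo 0 T := ⟨hs.1, hs.2.trans_le hτ.2⟩
    refine (((hu.hasDerivAt_dx s hs' x hx).mul (hdxx s x)).sub
      ((hu.hasDerivAt_dxx s hs' x hx).mul (hdx s x))).congr_deriv ?_
    ring
  have hftc := intervalIntegral.integral_eq_sub_of_hasDerivAt_of_le hLL
    (hprimitive.comp hpair.continuousOn hmaps) hder
    ((hcont.comp hpair.continuousOn hmaps).intervalIntegrable_of_Icc hLL)
  rw [intervalIntegral.integral_of_le hLL, integral_Ioc_eq_integral_Ioo] at hftc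
  simpa [(hb s hsI).1, (hb s hsI).2] using hftc

theorem weak_identity (hL : 0 < L) (hu : IsClassicalSolution L T u ut ux) (hτ : τ ∈ Icc 0 T)
    (hφ : ContDiff ℝ ∞ (Function.uncurry φ))
    (hb : ∀ t ∈ Icc (0 : ℝ) τ, φ t (-L) = 0 ∧ φ t L = 0) :
    ∫ x in Ioo (-L) L, u τ x * φ τ x =
      (∫ p in Ioo 0 τ ×ˢ Ioo (-L) L,
        u p.1 p.2 * (deriv (fun t => φ t p.2) p.1 + deriv (deriv (φ p.1)) p.2)) +
      ∫ t in Ioo 0 τ, (u t (-L) * deriv (φ t) (-L) - u t L * deriv (φ t) L) := by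
  obtain ⟨φt, φx, φxx, hφt, hφx, hφxx, hdt, hdx, hdxx⟩ := exists_partial_derivs hφ
  have hderiv_x : ∀ t, deriv (φ t) = fun x => φx (t, x) := fun t => funext fun x => (hdx t x).deriv
  simp only [hderiv_x, (hdt _ _).deriv, (hdxx _ _).deriv]
  have hsub : Icc 0 τ ×ˢ Icc (-L) L ⊆ Icc 0 T ×ˢ Icc (-L) L :=
    prod_mono_left (Icc_subset_Icc_right hτ.2)
  have hc := hu.continuousOn.mono hsub
  have hct := hu.continuousOn_dt.mono hsub
  have hφc := hφ.continuous
  have hint_t : IntegrableOn (fun p : ℝ × ℝ => ut p.1 p.2 * φ p.1 p.2 + u p.1 p.2 * φt p)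
      (Ioo 0 τ ×ˢ Ioo (-L) L) := integrableOn_Ioo_prod_Ioo_of_continuousOn
    ((hct.mul hφc.continuousOn).add (hc.mul hφt.continuousOn))
  have hint_x : IntegrableOn (fun p : ℝ × ℝ => u p.1 p.2 * φxx p - ut p.1 p.2 * φ p.1 p.2)
      (Ioo 0 τ ×ˢ Ioo (-L) L) := integrableOn_Ioo_prod_Ioo_of_continuousOn
    ((hc.mul hφxx.continuousOn).sub (hct.mul hφc.continuousOn))
  calc ∫ x in Ioo (-L) L, u τ x * φ τ x
    _ = (∫ p in Ioo 0 τ ×ˢ Ioo (-L) L, (ut p.1 p.2 * φ p.1 p.2 + u p.1 p.2 * φt p)) +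
          (∫ p in Ioo 0 τ ×ˢ Ioo (-L) L, (u p.1 p.2 * φxx p - ut p.1 p.2 * φ p.1 p.2)) -
          ∫ t in Ioo 0 τ, (u t L * φx (t, L) - u t (-L) * φx (t, -L)) := by
      rw [hu.setIntegral_dt_mul hτ hφc hφt hdt,
        hu.setIntegral_mul_dxx_sub hL hτ hφc hφx hφxx hdx hdxx hb, add_sub_cancel_right]
    _ = _ := by
      rw [← integral_add hint_t hint_x, sub_eq_add_neg, ← integral_neg]
      congr 1 <;> refine integral_congr_ae (.of_forall fun p => ?_) <;> ring

theorem isSolution (hL : 0 < L) (hu : IsClassicalSolution L T u ut ux) :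
    IsSolution L T (fun t => u t (-L)) (fun t => u t L) u where
  memLp := (memLp_of_continuousOn_of_isCompact hu.continuousOn
    (isCompact_Icc.prod isCompact_Icc) 2).mono_measure
    (Measure.restrict_mono (prod_mono Ioo_subset_Icc_self Ioo_subset_Icc_self) le_rfl)
  weak τ hτ φ hφ hb := by
    refine ⟨?_, hu.weak_identity hL hτ hφ hb⟩
    have hpair : Continuous fun x : ℝ => (τ, x) := by fun_prop
    have := (hu.continuousOn.comp hpair.continuousOn fun x hx => ⟨hτ, hx⟩).mul
      (hφ.continuous.comp hpair).continuousOn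
    exact this.integrableOn_Icc.mono_set Ioo_subset_Icc_self

end Transposition

end IsClassicalSolution

/-- `w` is the value at time `T` on `(-L,L)` of a classical solution that vanishes at time `0`. -/
def ClassicallyReachable (L T : ℝ) (w : ℝ → ℂ) : Prop :=
  ∃ u ut ux, IsClassicalSolution L T u ut ux ∧ ∀ x ∈ Ioo (-L) L, u T x = w x

namespace ClassicallyReachable

variable {L T : ℝ} {v w : ℝ → ℂ}

theorem congr (hv : ClassicallyReachable L T v) (h : ∀ x ∈ Ioo (-L) L, v x = w x) :
    ClassicallyReachable L T w := by
  obtain ⟨u, ut, ux, hu, huv⟩ := hv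
  exact ⟨u, ut, ux, hu, fun x hx => (huv x hx).trans (h x hx)⟩

theorem zero : ClassicallyReachable L T 0 :=
  ⟨0, 0, 0, .zero, fun _ _ => rfl⟩

theorem add (hv : ClassicallyReachable L T v) (hw : ClassicallyReachable L T w) :
    ClassicallyReachable L T (v + w) := by
  obtain ⟨u₁, _, _, hu₁, h₁⟩ := hv
  obtain ⟨u₂, _, _, hu₂, h₂⟩ := hw
  exact ⟨_, _, _, hu₁.add hu₂, fun x hx => by simp [h₁ x hx, h₂ x hx]⟩

theorem sum {ι : Type*} {S : Finset ι} {v : ι → ℝ → ℂ}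
    (hv : ∀ i ∈ S, ClassicallyReachable L T (v i)) :
    ClassicallyReachable L T (fun x => ∑ i ∈ S, v i x) := by
  have := Finset.sum_induction v (ClassicallyReachable L T) (fun _ _ => add) zero hv
  exact this.congr fun x _ => Finset.sum_apply x S v

theorem mem_reachableSet (hL : 0 < L) (hw : ClassicallyReachable L T w) :
    w ∈ reachableSet L T := by
  obtain ⟨u, ut, ux, hu, huw⟩ := hw
  have htrace : ∀ x ∈ Icc (-L) L, MemLp (fun t => u t x) 2 (volume.restrict (Ioo 0 T)) :=
    fun x hx => (memLp_of_continuousOn_of_isCompact (hu.continuousOn.comp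
      (by fun_prop : Continuous fun t : ℝ => (t, x)).continuousOn fun t ht => ⟨ht, hx⟩)
      isCompact_Icc 2).mono_measure (Measure.restrict_mono Ioo_subset_Icc_self le_rfl)
  have hLL : -L ≤ L := by linarith
  exact ⟨_, _, u, htrace _ (left_mem_Icc.2 hLL), htrace _ (right_mem_Icc.2 hLL), hu.isSolution hL,
    (ae_restrict_iff' measurableSet_Ioo).2 (.of_forall huw)⟩

end ClassicallyReachable

/-- The successive derivatives of a product, from those of the factors. -/
def jetMul (X Y : ℕ → ℝ → ℂ) (n : ℕ) (s : ℝ) : ℂ :=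
  ∑ ij ∈ Finset.HasAntidiagonal.antidiagonal n, (n.choose ij.1 : ℂ) * (X ij.1 s * Y ij.2 s)

theorem hasDerivAt_jetMul {X Y : ℕ → ℝ → ℂ} {s : ℝ}
    (hX : ∀ n, HasDerivAt (X n) (X (n + 1) s) s) (hY : ∀ n, HasDerivAt (Y n) (Y (n + 1) s) s)
    (n : ℕ) : HasDerivAt (jetMul X Y n) (jetMul X Y (n + 1) s) s := by
  have h : HasDerivAt (jetMul X Y n) (∑ ij ∈ Finset.HasAntidiagonal.antidiagonal n,
      (n.choose ij.1 : ℂ) * (X (ij.1 + 1) s * Y ij.2 s + X ij.1 s * Y (ij.2 + 1) s)) s :=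
    HasDerivAt.fun_sum fun ij _ => ((hX ij.1).mul (hY ij.2)).const_mul _
  refine h.congr_deriv ?_
  rw [jetMul, Finset.sum_antidiagonal_choose_succ_mul (fun i j => X i s * Y j s) n,
    ← Finset.sum_add_distrib]
  refine Finset.sum_congr rfl fun ij hij => ?_
  have : n.choose ij.2 = n.choose ij.1 :=
    Nat.choose_symm_of_eq_add (by rw [← Finset.HasAntidiagonal.mem_antidiagonal.1 hij, add_comm])
  rw [this]
  ring

theorem choose_mul_factorial_le (j k : ℕ) :
    (j + k).choose j * ((2 * j).factorial * (2 * k).factorial) ≤ (2 * (j + k)).factorial := by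
  have hchoose : (j + k).choose j ≤ (2 * j + 2 * k).choose (2 * j) := by
    calc (j + k).choose j = (j + k).choose k := by
          rw [← Nat.choose_symm_add]
      _ ≤ (2 * j + k).choose k := Nat.choose_le_choose _ (by omega)
      _ = (2 * j + k).choose (2 * j) := by rw [← Nat.choose_symm_add]
      _ ≤ _ := Nat.choose_le_choose _ (by omega)
  calc _ ≤ (2 * j + 2 * k).choose (2 * j) * ((2 * j).factorial * (2 * k).factorial) :=
        Nat.mul_le_mul_right _ hchoose
    _ = _ := by
      rw [← mul_assoc, Nat.choose_symm_add, mul_add]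
      exact Nat.add_choose_mul_factorial_mul_factorial _ _

theorem norm_jetMul_le {X Y : ℕ → ℝ → ℂ} {s C D ε : ℝ} (hε : 0 ≤ ε)
    (hX : ∀ n, ‖X n s‖ ≤ C * ε ^ n * (2 * n).factorial)
    (hY : ∀ n, ‖Y n s‖ ≤ D * ε ^ n * (2 * n).factorial) (n : ℕ) :
    ‖jetMul X Y n s‖ ≤ C * D * (2 * ε) ^ n * (2 * n).factorial := by
  have hC : 0 ≤ C := by simpa using (norm_nonneg _).trans (hX 0)
  have hD : 0 ≤ D := by simpa using (norm_nonneg _).trans (hY 0)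
  have hterm : ∀ ij ∈ Finset.HasAntidiagonal.antidiagonal n,
      ‖(n.choose ij.1 : ℂ) * (X ij.1 s * Y ij.2 s)‖ ≤ C * D * ε ^ n * (2 * n).factorial := by
    rintro ⟨j, k⟩ hjk
    obtain rfl : j + k = n := Finset.HasAntidiagonal.mem_antidiagonal.1 hjk
    have hfact : ((j + k).choose j : ℝ) * ((2 * j).factorial * (2 * k).factorial) ≤
        (2 * (j + k)).factorial := by exact_mod_cast choose_mul_factorial_le j k
    calc ‖((j + k).choose j : ℂ) * (X j s * Y k s)‖
        = ((j + k).choose j : ℝ) * (‖X j s‖ * ‖Y k s‖) := by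
          rw [norm_mul, norm_mul, Complex.norm_natCast]
      _ ≤ ((j + k).choose j : ℝ) *
          ((C * ε ^ j * (2 * j).factorial) * (D * ε ^ k * (2 * k).factorial)) := by
          gcongr
          · exact hX j
          · exact hY k
      _ = C * D * ε ^ (j + k) *
          (((j + k).choose j : ℝ) * ((2 * j).factorial * (2 * k).factorial)) := by
          rw [pow_add]; ring
      _ ≤ _ := by gcongr
  calc ‖jetMul X Y n s‖
    _ ≤ ∑ _ ∈ Finset.HasAntidiagonal.antidiagonal n, C * D * ε ^ n * (2 * n).factorial :=
        norm_sum_le_of_le _ hterm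
    _ = (n + 1 : ℕ) * (C * D * ε ^ n * (2 * n).factorial) := by
        rw [Finset.sum_const, Finset.Nat.card_antidiagonal, nsmul_eq_mul]
    _ ≤ (2 ^ n : ℕ) * (C * D * ε ^ n * (2 * n).factorial) := by
        gcongr
        exact Nat.lt_two_pow_self
    _ = _ := by push_cast; rw [mul_pow]; ring

theorem factorial_mul_self_le (n : ℕ) : (n.factorial * n.factorial : ℝ) ≤ (2 * n).factorial := by
  have := Nat.le_of_dvd (Nat.factorial_pos _) (Nat.factorial_mul_factorial_dvd_factorial_add n n)
  rw [← two_mul] at this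
  exact_mod_cast this

theorem pow_mul_exp_neg_le {a : ℝ} (ha : 0 < a) (n k : ℕ) {s : ℝ} (hs : 0 < s) :
    Real.exp (-(a / s)) / s ^ n ≤ (n + k).factorial / a ^ (n + k) * s ^ k := by
  have h := Real.pow_div_factorial_le_exp (a / s) (by positivity) (n + k)
  have hf : (0 : ℝ) < (n + k).factorial := by positivity
  rw [div_le_iff₀ hf, div_pow, div_le_iff₀ (by positivity)] at h
  rw [Real.exp_neg, div_le_iff₀ (by positivity), inv_le_iff_one_le_mul₀ (Real.exp_pos _)]
  have e : ((n + k).factorial / a ^ (n + k) * s ^ k * s ^ n) * Real.exp (a / s) =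
      (Real.exp (a / s) * (n + k).factorial * s ^ (n + k)) / a ^ (n + k) := by
    rw [pow_add s]; field_simp
  rw [mul_comm, mul_comm (Real.exp _), e]
  rwa [one_le_div (by positivity)]

/-- The successive derivatives of `exp (-M / s)`, extended by zero to `s ≤ 0`. They are written as
complex derivatives so that Cauchy's estimates apply. -/
def flatJet (M : ℝ) (n : ℕ) (s : ℝ) : ℂ :=
  if 0 < s then iteratedDeriv n (fun w : ℂ => Complex.exp (-M / w)) s else 0

theorem flatJet_of_nonpos (M : ℝ) (n : ℕ) {s : ℝ} (hs : s ≤ 0) : flatJet M n s = 0 :=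
  if_neg hs.not_gt

theorem differentiableOn_exp_neg_div (M : ℝ) :
    DifferentiableOn ℂ (fun w : ℂ => Complex.exp (-M / w)) {0}ᶜ := fun w (hw : w ≠ 0) =>
  DifferentiableAt.differentiableWithinAt (by fun_prop (disch := assumption))

theorem half_le_re_of_mem_closedBall {s : ℝ} {w : ℂ}
    (hw : w ∈ Metric.closedBall (s : ℂ) (s / 2)) : s / 2 ≤ w.re := by
  rw [Metric.mem_closedBall, dist_eq_norm] at hw
  have := (abs_le.1 ((Complex.abs_re_le_norm (w - s)).trans hw)).1
  rw [Complex.sub_re, Complex.ofReal_re] at this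
  linarith

theorem norm_exp_neg_div_le {M : ℝ} (hM : 0 ≤ M) {s : ℝ} (hs : 0 < s) {w : ℂ}
    (hw : w ∈ Metric.closedBall (s : ℂ) (s / 2)) :
    ‖Complex.exp (-M / w)‖ ≤ Real.exp (-((2 * M / 9) / s)) := by
  have hre := half_le_re_of_mem_closedBall hw
  have hnorm : ‖w‖ ≤ 3 * s / 2 := by
    have := norm_le_norm_add_norm_sub' w (s : ℂ)
    rw [Metric.mem_closedBall, dist_eq_norm] at hw
    rw [Complex.norm_real, Real.norm_of_nonneg hs.le] at this
    linarith
  have hw0 : 0 < ‖w‖ := by linarith [Complex.re_le_norm w]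
  have hquot : (-(M : ℂ) / w).re = -(M * (w.re / ‖w‖ ^ 2)) := by
    rw [neg_div, Complex.neg_re, div_eq_mul_inv, Complex.re_ofReal_mul, Complex.inv_re,
      Complex.normSq_eq_norm_sq]
  rw [Complex.norm_exp, hquot, Real.exp_le_exp, neg_le_neg_iff, mul_comm 2 M, mul_div_assoc,
    mul_div_assoc]
  refine mul_le_mul_of_nonneg_left ?_ hM
  rw [le_div_iff₀ (by positivity), div_mul_eq_mul_div, div_le_iff₀ hs]
  nlinarith [mul_self_le_mul_self (norm_nonneg w) hnorm]

theorem norm_flatJet_le_exp {M : ℝ} (hM : 0 ≤ M) (n : ℕ) {s : ℝ} (hs : 0 < s) :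
    ‖flatJet M n s‖ ≤ n.factorial * 2 ^ n * (Real.exp (-((2 * M / 9) / s)) / s ^ n) := by
  have hsub : Metric.closedBall (s : ℂ) (s / 2) ⊆ {0}ᶜ := fun w hw h0 => by
    have := half_le_re_of_mem_closedBall hw
    rw [mem_singleton_iff.1 h0, Complex.zero_re] at this
    linarith
  have hcauchy := Complex.norm_iteratedDeriv_le_of_forall_mem_sphere_norm_le n (half_pos hs)
    (((differentiableOn_exp_neg_div M).mono hsub).diffContOnCl_ball subset_rfl)
    fun w hw => norm_exp_neg_div_le hM hs (Metric.sphere_subset_closedBall hw)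
  rw [flatJet, if_pos hs]
  refine hcauchy.trans (le_of_eq ?_)
  rw [div_pow]
  field_simp

theorem norm_flatJet_le {M : ℝ} (hM : 0 < M) (n : ℕ) (s : ℝ) :
    ‖flatJet M n s‖ ≤ 1 * (9 / M) ^ n * (2 * n).factorial := by
  rcases lt_or_ge 0 s with hs | hs
  · calc _ ≤ _ := norm_flatJet_le_exp hM.le n hs
      _ ≤ n.factorial * 2 ^ n * ((n + 0).factorial / (2 * M / 9) ^ (n + 0) * s ^ 0) := by
          gcongr
          exact pow_mul_exp_neg_le (by positivity) n 0 hs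
      _ = (9 / M) ^ n * (n.factorial * n.factorial) := by
          simp only [add_zero, pow_zero, div_pow, mul_pow]
          field_simp
      _ ≤ (9 / M) ^ n * (2 * n).factorial := by gcongr; exact factorial_mul_self_le n
      _ = _ := by ring
  · rw [flatJet_of_nonpos M n hs, norm_zero]
    positivity

theorem hasDerivAt_flatJet_zero {M : ℝ} (hM : 0 < M) (n : ℕ) : HasDerivAt (flatJet M n) 0 0 := by
  have hO : flatJet M n =O[nhds 0] fun x : ℝ => ‖x - 0‖ ^ 2 := by
    refine Asymptotics.IsBigO.of_bound
      (n.factorial * 2 ^ n * ((n + 2).factorial / (2 * M / 9) ^ (n + 2))) (.of_forall fun x => ?_)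
    rcases lt_or_ge 0 x with hx | hx
    · calc _ ≤ _ := norm_flatJet_le_exp hM.le n hx
        _ ≤ n.factorial * 2 ^ n * ((n + 2).factorial / (2 * M / 9) ^ (n + 2) * x ^ 2) := by
            gcongr
            exact pow_mul_exp_neg_le (by positivity) n 2 hx
        _ = _ := by simp [mul_assoc]
    · rw [flatJet_of_nonpos M _ hx, norm_zero]
      positivity
  simpa using (hO.hasFDerivAt one_lt_two).hasDerivAt

theorem hasDerivAt_flatJet {M : ℝ} (hM : 0 < M) (n : ℕ) (s : ℝ) :
    HasDerivAt (flatJet M n) (flatJet M (n + 1) s) s := by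
  rcases lt_trichotomy 0 s with hs | rfl | hs
  · have hanalytic := ((differentiableOn_exp_neg_div M).analyticOnNhd
      isOpen_compl_singleton).iterated_deriv n s (by simpa using hs.ne')
    rw [← iteratedDeriv_eq_iterate] at hanalytic
    have hder := hanalytic.differentiableAt.hasDerivAt.comp_ofReal
    rw [← iteratedDeriv_succ] at hder
    rw [flatJet, if_pos hs]
    refine hder.congr_of_eventuallyEq ?_
    filter_upwards [lt_mem_nhds hs] with r hr
    rw [flatJet, if_pos hr]
  · rw [flatJet_of_nonpos M _ le_rfl]
    exact hasDerivAt_flatJet_zero hM n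
  · rw [flatJet_of_nonpos M _ hs.le]
    refine (hasDerivAt_const s (0 : ℂ)).congr_of_eventuallyEq ?_
    filter_upwards [gt_mem_nhds hs] with r hr
    exact flatJet_of_nonpos M _ hr.le

/-- The successive derivatives of the bump `exp (-M / s) * exp (-M / (T - s))` on `(0,T)`, extended
by zero. -/
def bumpJet (M T : ℝ) : ℕ → ℝ → ℂ :=
  jetMul (flatJet M) fun n s => (-1) ^ n * flatJet M n (T - s)

section Bump

variable {M T : ℝ}

theorem hasDerivAt_bumpJet (hM : 0 < M) (n : ℕ) (s : ℝ) :
    HasDerivAt (bumpJet M T n) (bumpJet M T (n + 1) s) s := by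
  refine hasDerivAt_jetMul (fun k => hasDerivAt_flatJet hM k s) (fun k => ?_) n
  have h := ((hasDerivAt_flatJet hM k (T - s)).scomp s ((hasDerivAt_id s).const_sub T)).const_mul
    ((-1 : ℂ) ^ k)
  refine h.congr_deriv ?_
  simp [pow_succ]

theorem continuous_bumpJet (hM : 0 < M) (n : ℕ) : Continuous (bumpJet M T n) :=
  continuous_iff_continuousAt.2 fun s => (hasDerivAt_bumpJet hM n s).continuousAt

theorem norm_bumpJet_le (hM : 0 < M) (n : ℕ) (s : ℝ) :
    ‖bumpJet M T n s‖ ≤ (18 / M) ^ n * (2 * n).factorial := by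
  have h := norm_jetMul_le (Y := fun n s => (-1) ^ n * flatJet M n (T - s)) (by positivity)
    (D := 1) (fun k => norm_flatJet_le hM k s)
    (fun k => by simpa using norm_flatJet_le hM k (T - s)) n
  have hrate : 2 * (9 / M) = 18 / M := by ring
  simpa only [bumpJet, hrate, one_mul] using h

theorem bumpJet_of_nonpos (n : ℕ) {s : ℝ} (hs : s ≤ 0) : bumpJet M T n s = 0 := by
  simp [bumpJet, jetMul, flatJet_of_nonpos M _ hs]

theorem bumpJet_self (n : ℕ) : bumpJet M T n T = 0 := by
  simp [bumpJet, jetMul, flatJet_of_nonpos M _ le_rfl]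

theorem bumpJet_zero_apply {s : ℝ} (hs : s ∈ Ioo 0 T) :
    bumpJet M T 0 s = (Real.exp (-M / s) * Real.exp (-M / (T - s)) : ℝ) := by
  simp [bumpJet, jetMul, flatJet, hs.1, hs.2]

theorem integral_bumpJet_zero_ne_zero (hM : 0 < M) (hT : 0 < T) :
    ∫ s in (0 : ℝ)..T, bumpJet M T 0 s ≠ 0 := by
  have hcont : Continuous (bumpJet M T 0) := continuous_bumpJet hM 0
  have hpos := intervalIntegral.intervalIntegral_pos_of_pos_on
    ((Complex.continuous_re.comp hcont).intervalIntegrable 0 T) (fun s hs => by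
      rw [Function.comp_apply, bumpJet_zero_apply hs, Complex.ofReal_re]
      positivity) hT
  intro h0
  have hre := Complex.reCLM.intervalIntegral_comp_comm (hcont.intervalIntegrable (μ := volume) 0 T)
  exact hpos.ne' (hre.trans (by rw [h0, map_zero]))

/-- The successive derivatives of the normalised primitive of the bump, which is `0` up to time `0`
and `1` at time `T`. -/
def stepJet (M T : ℝ) : ℕ → ℝ → ℂ
  | 0, s => (∫ r in (0 : ℝ)..s, bumpJet M T 0 r) / ∫ r in (0 : ℝ)..T, bumpJet M T 0 r
  | n + 1, s => bumpJet M T n s / ∫ r in (0 : ℝ)..T, bumpJet M T 0 r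

theorem hasDerivAt_stepJet (hM : 0 < M) (n : ℕ) (s : ℝ) :
    HasDerivAt (stepJet M T n) (stepJet M T (n + 1) s) s := by
  cases n with
  | zero => exact ((continuous_bumpJet hM 0).integral_hasStrictDerivAt 0 s).hasDerivAt.div_const _
  | succ m => exact (hasDerivAt_bumpJet hM m s).div_const _

theorem stepJet_of_nonpos (n : ℕ) {s : ℝ} (hs : s ≤ 0) : stepJet M T n s = 0 := by
  cases n with
  | zero =>
    have : ∫ r in (0 : ℝ)..s, bumpJet M T 0 r = 0 := by
      rw [intervalIntegral.integral_symm, intervalIntegral.integral_of_le hs,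
        setIntegral_congr_fun measurableSet_Ioc fun r hr => bumpJet_of_nonpos 0 hr.2]
      rw [integral_zero, neg_zero]
    rw [stepJet, this, zero_div]
  | succ m => rw [stepJet, bumpJet_of_nonpos m hs, zero_div]

theorem stepJet_zero_self (hM : 0 < M) (hT : 0 < T) : stepJet M T 0 T = 1 :=
  div_self (integral_bumpJet_zero_ne_zero hM hT)

theorem stepJet_succ_self (n : ℕ) : stepJet M T (n + 1) T = 0 := by
  rw [stepJet, bumpJet_self, zero_div]

theorem exists_norm_stepJet_le (hM : 0 < M) (hT : 0 < T) :
    ∃ C, ∀ n, ∀ s ∈ Icc 0 T, ‖stepJet M T n s‖ ≤ C * (18 / M) ^ n * (2 * n).factorial := by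
  obtain ⟨C₀, hC₀⟩ := isCompact_Icc.exists_bound_of_continuousOn (s := Icc 0 T)
    (f := stepJet M T 0) fun s _ => (hasDerivAt_stepJet hM 0 s).continuousAt.continuousWithinAt
  have hC₀' : 0 ≤ C₀ := (norm_nonneg _).trans (hC₀ 0 (left_mem_Icc.2 hT.le))
  set I : ℂ := ∫ s in (0 : ℝ)..T, bumpJet M T 0 s
  have hI0 : 0 < ‖I‖ := norm_pos_iff.2 (integral_bumpJet_zero_ne_zero hM hT)
  refine ⟨C₀ + M / (18 * ‖I‖), fun n s hs => ?_⟩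
  cases n with
  | zero => exact (hC₀ s hs).trans (by simpa using by positivity)
  | succ m =>
    have hfact : ((2 * m).factorial : ℝ) ≤ (2 * (m + 1)).factorial := by
      exact_mod_cast Nat.factorial_le (by lia)
    calc ‖stepJet M T (m + 1) s‖ = ‖bumpJet M T m s‖ / ‖I‖ := by rw [stepJet, norm_div]
      _ ≤ ((18 / M) ^ m * (2 * (m + 1)).factorial) / ‖I‖ := by
          gcongr
          exact (norm_bumpJet_le hM m s).trans (by gcongr)
      _ = (0 + M / (18 * ‖I‖)) * (18 / M) ^ (m + 1) * (2 * (m + 1)).factorial := by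
          rw [pow_succ, zero_add]
          field_simp
      _ ≤ _ := by gcongr

end Bump

/-- The exponential generating function `∑ bₙ xⁿ / n!` of a sequence. -/
def egf (b : ℕ → ℂ) (x : ℝ) : ℂ := ∑' n, b n * ((x : ℂ) ^ n / n.factorial)

section Egf

variable {b : ℕ → ℂ} {ρ D : ℝ}

theorem norm_egf_term_le (hρ : 0 < ρ) (hb : ∀ n, ‖b n‖ * ρ ^ n ≤ D * n.factorial) {x r : ℝ}
    (hx : |x| ≤ r) (n : ℕ) : ‖b n * ((x : ℂ) ^ n / n.factorial)‖ ≤ D * (r / ρ) ^ n := by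
  have h := hb n
  rw [← le_div_iff₀ (by positivity)] at h
  rw [norm_mul, norm_div, norm_pow, Complex.norm_real, Real.norm_eq_abs, Complex.norm_natCast]
  calc ‖b n‖ * (|x| ^ n / n.factorial) ≤ (D * n.factorial / ρ ^ n) * (r ^ n / n.factorial) := by
        gcongr
        exact (norm_nonneg _).trans h
    _ = D * (r / ρ) ^ n := by rw [div_pow]; field_simp

theorem summable_egf (hρ : 0 < ρ) (hb : ∀ n, ‖b n‖ * ρ ^ n ≤ D * n.factorial) {x : ℝ}
    (hx : |x| < ρ) : Summable fun n => b n * ((x : ℂ) ^ n / n.factorial) :=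
  ((summable_geometric_of_lt_one (by positivity) ((div_lt_one hρ).2 hx)).mul_left D).of_norm_bounded
    (norm_egf_term_le hρ hb le_rfl)

theorem norm_egf_le (hρ : 0 < ρ) (hb : ∀ n, ‖b n‖ * ρ ^ n ≤ D * n.factorial) {x : ℝ}
    (hx : |x| ≤ ρ / 2) : ‖egf b x‖ ≤ D * 2 := by
  have h := norm_egf_term_le hρ hb hx
  rw [show ρ / 2 / ρ = 1 / 2 by field_simp] at h
  exact tsum_of_norm_bounded (hasSum_geometric_two.mul_left D) h

theorem egf_zero (b : ℕ → ℂ) : egf b 0 = b 0 := by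
  rw [egf, tsum_eq_single 0 fun n hn => by simp [hn]]
  simp

theorem mul_pow_succ_le_factorial (hρ : 0 < ρ) (hb : ∀ n, ‖b n‖ * ρ ^ n ≤ D * n.factorial)
    (n : ℕ) : ‖b (n + 1)‖ * (ρ / 2) ^ n ≤ D / ρ * n.factorial := by
  have hD : 0 ≤ D := by simpa using (norm_nonneg _).trans (by simpa using hb 0)
  have h := hb (n + 1)
  have hn : ((n + 1 : ℕ) : ℝ) ≤ 2 ^ n := by exact_mod_cast Nat.lt_two_pow_self
  rw [pow_succ, ← mul_assoc, ← le_div_iff₀ hρ] at h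
  rw [div_pow, ← mul_div_assoc, div_le_iff₀ (by positivity)]
  refine h.trans ?_
  rw [Nat.factorial_succ, Nat.cast_mul]
  calc D * (((n + 1 : ℕ) : ℝ) * n.factorial) / ρ ≤ D * (2 ^ n * n.factorial) / ρ := by gcongr
    _ = D / ρ * n.factorial * 2 ^ n := by ring

theorem hasDerivAt_egf_term (b : ℕ → ℂ) (n : ℕ) (x : ℝ) :
    HasDerivAt (fun y : ℝ => b (n + 1) * ((y : ℂ) ^ (n + 1) / (n + 1).factorial))
      (b (n + 1) * ((x : ℂ) ^ n / n.factorial)) x := by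
  refine (((hasDerivAt_pow (n + 1) (x : ℂ)).comp_ofReal.div_const
    ((n + 1).factorial : ℂ)).const_mul (b (n + 1))).congr_deriv ?_
  have : ((n + 1 : ℕ) : ℂ) ≠ 0 := Nat.cast_ne_zero.2 n.succ_ne_zero
  rw [Nat.factorial_succ, Nat.cast_mul, Nat.add_sub_cancel, mul_div_mul_left _ _ this]

theorem hasDerivAt_egf (hb : ∀ n, ‖b n‖ * ρ ^ n ≤ D * n.factorial) {x : ℝ} (hx : |x| < ρ / 2) :
    HasDerivAt (egf b) (egf (fun n => b (n + 1)) x) x := by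
  have hρ : 0 < ρ := by linarith [abs_nonneg x]
  obtain ⟨r, hxr, hrρ⟩ := exists_between hx
  have hr : 0 < r := (abs_nonneg x).trans_lt hxr
  have hsum : Summable fun n : ℕ => D / ρ * (r / (ρ / 2)) ^ n :=
    (summable_geometric_of_lt_one (by positivity) ((div_lt_one (by positivity)).2 hrρ)).mul_left _
  have htail : HasDerivAt (fun y : ℝ => ∑' n, b (n + 1) * ((y : ℂ) ^ (n + 1) / (n + 1).factorial))
      (egf (fun n => b (n + 1)) x) x :=
    hasDerivAt_tsum_of_isPreconnected hsum isOpen_Ioo isPreconnected_Ioo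
      (fun n y _ => hasDerivAt_egf_term b n y)
      (fun n y hy => norm_egf_term_le (b := fun n => b (n + 1)) (by positivity)
        (mul_pow_succ_le_factorial hρ hb) (abs_lt.2 hy).le n)
      (y₀ := 0) ⟨by linarith, hr⟩ (by simp) (abs_lt.1 hxr)
  refine (htail.const_add (b 0)).congr_of_eventuallyEq ?_
  filter_upwards [continuous_abs.continuousAt.eventually_lt_const hx] with y hy
  rw [egf, (summable_egf hρ hb (by linarith)).tsum_eq_zero_add]
  simp

end Egf

section FlatOutput

variable {G : ℕ → ℝ → ℂ} {ρ D L T : ℝ}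

theorem continuousOn_egf {S : Set ℝ} (hL : 0 ≤ L) (hLρ : L < ρ)
    (hG : ∀ n, ContinuousOn (G n) S) (hb : ∀ s ∈ S, ∀ n, ‖G n s‖ * ρ ^ n ≤ D * n.factorial) :
    ContinuousOn (fun p : ℝ × ℝ => egf (fun n => G n p.1) p.2) (S ×ˢ Icc (-L) L) := by
  have hρ := hL.trans_lt hLρ
  refine continuousOn_tsum (u := fun n => D * (L / ρ) ^ n) (fun n => ?_) ?_ ?_
  · refine ((hG n).comp continuousOn_fst fun p hp => hp.1).mul ?_
    exact (by fun_prop : Continuous fun p : ℝ × ℝ => (p.2 : ℂ) ^ n / (n.factorial : ℂ)).continuousOn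
  · exact (summable_geometric_of_lt_one (by positivity) ((div_lt_one hρ).2 hLρ)).mul_left D
  · intro n p hp
    exact norm_egf_term_le hρ (hb p.1 hp.1) (abs_le.2 hp.2) n

theorem hasDerivAt_egf_param {G' : ℕ → ℝ → ℂ} (hρ : 0 < ρ)
    (hG : ∀ n, ∀ s ∈ Ioo 0 T, HasDerivAt (G n) (G' n s) s)
    (hb : ∀ s ∈ Ioo 0 T, ∀ n, ‖G' n s‖ * ρ ^ n ≤ D * n.factorial) {s x : ℝ} (hs : s ∈ Ioo 0 T)
    (hx : |x| < ρ) (hsum : Summable fun n => G n s * ((x : ℂ) ^ n / n.factorial)) :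
    HasDerivAt (fun r => egf (fun n => G n r) x) (egf (fun n => G' n s) x) s :=
  hasDerivAt_tsum_of_isPreconnected
    ((summable_geometric_of_lt_one (by positivity) ((div_lt_one hρ).2 hx)).mul_left D) isOpen_Ioo
    isPreconnected_Ioo (fun n r hr => (hG n r hr).mul_const _)
    (fun n r hr => norm_egf_term_le hρ (hb r hr) le_rfl n) hs hsum hs

theorem isClassicalSolution_egf (hL : 0 < L)
    (hG : ∀ n, ∀ s ∈ Icc 0 T, HasDerivAt (G n) (G (n + 2) s) s) (h0 : ∀ n, G n 0 = 0)
    (hb : ∀ s ∈ Icc 0 T, ∀ n, ‖G n s‖ * (16 * L) ^ n ≤ D * n.factorial) :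
    IsClassicalSolution L T (fun s => egf fun n => G n s) (fun s => egf fun n => G (n + 2) s)
      (fun s => egf fun n => G (n + 1) s) := by
  have hcont : ∀ n, ContinuousOn (G n) (Icc 0 T) := fun n s hs =>
    (hG n s hs).continuousAt.continuousWithinAt
  have hb1 : ∀ s ∈ Icc 0 T, ∀ n, ‖G (n + 1) s‖ * (16 * L / 2) ^ n ≤ D / (16 * L) * n.factorial :=
    fun s hs n => mul_pow_succ_le_factorial (b := fun n => G n s) (by positivity) (hb s hs) n
  have hb2 : ∀ s ∈ Icc 0 T, ∀ n, ‖G (n + 2) s‖ * (16 * L / 2 / 2) ^ n ≤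
      D / (16 * L) / (16 * L / 2) * n.factorial := fun s hs n =>
    mul_pow_succ_le_factorial (b := fun n => G (n + 1) s) (by positivity) (hb1 s hs) n
  have hI : Ioo 0 T ⊆ Icc 0 T := Ioo_subset_Icc_self
  refine ⟨continuousOn_egf hL.le (by linarith) hcont hb,
    continuousOn_egf hL.le (by linarith) (fun n => hcont (n + 2)) hb2,
    continuousOn_egf hL.le (by linarith) (fun n => hcont (n + 1)) hb1,
    fun s hs x hx => ?_, fun s hs x hx => ?_, fun s hs x hx => ?_, fun x _ => by simp [egf, h0]⟩
  all_goals have hx' : |x| < L := abs_lt.2 hx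
  · exact hasDerivAt_egf_param (by positivity) (fun n s hs => hG n s (hI hs))
      (fun s hs => hb2 s (hI hs)) hs (by linarith)
      (summable_egf (by positivity) (hb s (hI hs)) (by linarith))
  · exact hasDerivAt_egf (hb s (hI hs)) (by linarith)
  · exact hasDerivAt_egf (b := fun n => G (n + 1) s) (hb1 s (hI hs)) (by linarith)

end FlatOutput

/-- The derivatives at `x = 0` of the backward heat evolution of `egf a` from time `T`: the `n`-th
derivative at time `s` is `∑ₖ a_{n+2k} (s - T)ᵏ / k!`. -/
def heatTrace (a : ℕ → ℂ) (T : ℝ) (n : ℕ) (s : ℝ) : ℂ := egf (fun k => a (n + 2 * k)) (s - T)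

section HeatTrace

variable {a : ℕ → ℂ} {C R T s : ℝ}

theorem norm_mul_pow_le_of_gaussian (hR : 0 < R)
    (ha : ∀ n, ‖a n‖ ≤ C * R ^ (n / 2) * (n / 2).factorial) (n k : ℕ) :
    ‖a (n + 2 * k)‖ * (1 / (2 * R)) ^ k ≤
      C * (2 * R) ^ (n / 2) * (n / 2).factorial * k.factorial := by
  have hC : 0 ≤ C := by simpa using (norm_nonneg _).trans (ha 0)
  have hcoeff := ha (n + 2 * k)
  rw [show (n + 2 * k) / 2 = n / 2 + k by lia] at hcoeff
  have hfact : ((n / 2 + k).factorial : ℝ) ≤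
      2 ^ (n / 2 + k) * ((n / 2).factorial * k.factorial) := by
    rw [← Nat.add_choose_mul_factorial_mul_factorial, mul_assoc]
    exact_mod_cast Nat.mul_le_mul_right _ (Nat.choose_le_two_pow _ _)
  calc ‖a (n + 2 * k)‖ * (1 / (2 * R)) ^ k
      ≤ (C * R ^ (n / 2 + k) * (2 ^ (n / 2 + k) * ((n / 2).factorial * k.factorial))) *
          (1 / (2 * R)) ^ k := by
        gcongr
        exact hcoeff.trans (by gcongr)
    _ = C * (2 * R) ^ (n / 2) * (n / 2).factorial * k.factorial * (2 * R * (1 / (2 * R))) ^ k := by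
        rw [pow_add, pow_add, mul_pow, mul_pow, mul_pow]; ring
    _ = C * (2 * R) ^ (n / 2) * (n / 2).factorial * k.factorial := by
        rw [mul_one_div_cancel (by positivity), one_pow, mul_one]

theorem hasDerivAt_heatTrace (hR : 0 < R)
    (ha : ∀ n, ‖a n‖ ≤ C * R ^ (n / 2) * (n / 2).factorial) (n : ℕ)
    (hs : |s - T| < 1 / (2 * R) / 2) :
    HasDerivAt (heatTrace a T n) (heatTrace a T (n + 2) s) s := by
  refine ((hasDerivAt_egf (norm_mul_pow_le_of_gaussian hR ha n) hs).comp_sub_const s T).congr_deriv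
    ?_
  simp only [heatTrace, mul_add, add_assoc, mul_one, add_comm (2 : ℕ)]

theorem norm_heatTrace_le (hR : 0 < R)
    (ha : ∀ n, ‖a n‖ ≤ C * R ^ (n / 2) * (n / 2).factorial) (n : ℕ)
    (hs : |s - T| ≤ 1 / (2 * R) / 2) :
    ‖heatTrace a T n s‖ ≤ C * (2 * R) ^ (n / 2) * (n / 2).factorial * 2 :=
  norm_egf_le (by positivity) (norm_mul_pow_le_of_gaussian hR ha n) hs

theorem norm_heatTrace_le_factorial (hR : 0 < R)
    (ha : ∀ n, ‖a n‖ ≤ C * R ^ (n / 2) * (n / 2).factorial) {ε : ℝ} (hε : 0 < ε) {b : ℕ}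
    (hb : b < 2) (n : ℕ) (hs : |s - T| ≤ 1 / (2 * R) / 2) :
    ‖heatTrace a T (b + 2 * n) s‖ ≤
      2 * C * Real.exp (2 * R / ε) * ε ^ n * (2 * n).factorial := by
  have hC : 0 ≤ C := by simpa using (norm_nonneg _).trans (ha 0)
  have htrace := norm_heatTrace_le hR ha (b + 2 * n) hs
  rw [show (b + 2 * n) / 2 = n by lia] at htrace
  have hexp := Real.pow_div_factorial_le_exp (2 * R / ε) (by positivity) n
  rw [div_le_iff₀ (by positivity), div_pow, div_le_iff₀ (by positivity)] at hexp
  calc ‖heatTrace a T (b + 2 * n) s‖ ≤ C * (2 * R) ^ n * n.factorial * 2 := htrace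
    _ ≤ C * (Real.exp (2 * R / ε) * n.factorial * ε ^ n) * n.factorial * 2 := by gcongr
    _ = 2 * C * Real.exp (2 * R / ε) * ε ^ n * (n.factorial * n.factorial) := by ring
    _ ≤ _ := by gcongr; exact factorial_mul_self_le n

theorem heatTrace_self (a : ℕ → ℂ) (T : ℝ) (n : ℕ) : heatTrace a T n T = a n := by
  rw [heatTrace, sub_self, egf_zero, mul_zero, add_zero]

end HeatTrace

/-- The successive time derivatives of the flat outputs `u(s,0)` (for `b = 0`) and `∂ₓu(s,0)` (for
`b = 1`) of a solution steering `0` to `egf a`: the traces of the backward evolution, switched on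
between the times `T - T₁` and `T`. -/
def switchedTrace (M T₁ T : ℝ) (a : ℕ → ℂ) (b : ℕ) : ℕ → ℝ → ℂ :=
  jetMul (fun n s => stepJet M T₁ n (s - (T - T₁))) fun n => heatTrace a T (b + 2 * n)

section SwitchedTrace

variable {a : ℕ → ℂ} {b : ℕ} {C M R T₁ T s : ℝ}

theorem switchedTrace_of_le (n : ℕ) (hs : s ≤ T - T₁) : switchedTrace M T₁ T a b n s = 0 := by
  simp [switchedTrace, jetMul, stepJet_of_nonpos _ (sub_nonpos.2 hs)]

theorem switchedTrace_self (hM : 0 < M) (hT₁ : 0 < T₁) (n : ℕ) :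
    switchedTrace M T₁ T a b n T = a (b + 2 * n) := by
  rw [switchedTrace, jetMul, Finset.sum_eq_single (0, n)]
  · simp [stepJet_zero_self hM hT₁, heatTrace_self]
  · rintro ⟨_ | j, k⟩ hjk hne
    · exact absurd (by simpa using hjk) fun h : k = n => hne (by rw [h])
    · simp [stepJet_succ_self]
  · simp

theorem hasDerivAt_switchedTrace (hM : 0 < M) (hR : 0 < R) (hT₁ : T₁ < 1 / (2 * R) / 2)
    (ha : ∀ n, ‖a n‖ ≤ C * R ^ (n / 2) * (n / 2).factorial) (hs : s ≤ T) (n : ℕ) :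
    HasDerivAt (switchedTrace M T₁ T a b n) (switchedTrace M T₁ T a b (n + 1) s) s := by
  rcases lt_or_ge s (T - T₁) with h | h
  · rw [switchedTrace_of_le _ h.le]
    refine (hasDerivAt_const s (0 : ℂ)).congr_of_eventuallyEq ?_
    filter_upwards [gt_mem_nhds h] with r hr using switchedTrace_of_le n (le_of_lt hr)
  · have hsT : |s - T| < 1 / (2 * R) / 2 := by
      rw [abs_of_nonpos (by linarith)]
      linarith
    exact hasDerivAt_jetMul (fun n => (hasDerivAt_stepJet hM n _).comp_sub_const s (T - T₁))
      (fun n => hasDerivAt_heatTrace hR ha (b + 2 * n) hsT) n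

theorem exists_norm_switchedTrace_le (hM : 0 < M) (hR : 0 < R) (hT₁0 : 0 < T₁)
    (hT₁ : T₁ < 1 / (2 * R) / 2) (ha : ∀ n, ‖a n‖ ≤ C * R ^ (n / 2) * (n / 2).factorial) :
    ∃ D, 0 ≤ D ∧ ∀ b < 2, ∀ n, ∀ s ≤ T,
      ‖switchedTrace M T₁ T a b n s‖ ≤ D * (2 * (18 / M)) ^ n * (2 * n).factorial := by
  have hC : 0 ≤ C := by simpa using (norm_nonneg _).trans (ha 0)
  obtain ⟨B, hB⟩ := exists_norm_stepJet_le hM hT₁0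
  have hB0 : 0 ≤ B := by simpa using (norm_nonneg _).trans (hB 0 0 (left_mem_Icc.2 hT₁0.le))
  refine ⟨B * (2 * C * Real.exp (2 * R / (18 / M))), by positivity, fun b hb n s hs => ?_⟩
  rcases lt_or_ge s (T - T₁) with h | h
  · rw [switchedTrace_of_le n h.le, norm_zero]
    positivity
  · have hsT : |s - T| ≤ 1 / (2 * R) / 2 := by
      rw [abs_of_nonpos (by linarith)]
      linarith
    exact norm_jetMul_le (X := fun n s => stepJet M T₁ n (s - (T - T₁)))
      (Y := fun n => heatTrace a T (b + 2 * n)) (s := s) (by positivity)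
      (fun n => hB n _ ⟨by linarith, by linarith⟩)
      (fun n => norm_heatTrace_le_factorial hR ha (by positivity) hb n hsT) n

end SwitchedTrace

section EntireState

variable {L T C : ℝ}

/- `M` is such that the bound `(2 · 18 / M)ⁿ (2n)!` on the flat outputs makes the series converge
for `|x| < 16 L`. -/
theorem classicallyReachable_egf {R : ℝ} (hL : 0 < L) (hT : 0 < T) (hR : 0 < R) {a : ℕ → ℂ}
    (ha : ∀ n, ‖a n‖ ≤ C * R ^ (n / 2) * (n / 2).factorial) :
    ClassicallyReachable L T (egf a) := by
  obtain ⟨T₁, hT₁0, hT₁⟩ := exists_between (lt_min hT (by positivity : 0 < 1 / (2 * R) / 2))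
  have hT₁T : T₁ < T := hT₁.trans_le (min_le_left _ _)
  replace hT₁ : T₁ < 1 / (2 * R) / 2 := hT₁.trans_le (min_le_right _ _)
  set M : ℝ := 36 * (16 * L) ^ 2 with hMdef
  have hM : 0 < M := by positivity
  obtain ⟨D, hD, hbound⟩ := exists_norm_switchedTrace_le (T := T) hM hR hT₁0 hT₁ ha
  set G : ℕ → ℝ → ℂ := fun n => switchedTrace M T₁ T a (n % 2) (n / 2) with hG
  have hfinal : ∀ n, G n T = a n := fun n => by
    simp only [hG, switchedTrace_self hM hT₁0, Nat.mod_add_div]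
  have hderiv : ∀ n, ∀ s ∈ Icc 0 T, HasDerivAt (G n) (G (n + 2) s) s := fun n s hs => by
    simp only [hG, Nat.add_mod_right, Nat.add_div_right n two_pos]
    exact hasDerivAt_switchedTrace hM hR hT₁ ha hs.2 (n / 2)
  have hGbound : ∀ s ∈ Icc 0 T, ∀ n, ‖G n s‖ * (16 * L) ^ n ≤ D * (1 + 16 * L) * n.factorial := by
    intro s hs n
    have hpow : (16 * L) ^ (n % 2) ≤ 1 + 16 * L := by
      rcases Nat.mod_two_eq_zero_or_one n with h | h <;> simp [h, hL.le]
    have hcancel : (2 * (18 / M)) ^ (n / 2) * (16 * L) ^ n = (16 * L) ^ (n % 2) := by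
      have hone : 2 * (18 / M) * (16 * L) ^ 2 = 1 := by rw [hMdef]; field_simp; norm_num
      nth_rewrite 2 [← Nat.div_add_mod n 2]
      rw [pow_add, pow_mul, ← mul_assoc, ← mul_pow, hone, one_pow, one_mul]
    calc ‖G n s‖ * (16 * L) ^ n
        ≤ (D * (2 * (18 / M)) ^ (n / 2) * (2 * (n / 2)).factorial) * (16 * L) ^ n := by
          gcongr
          exact hbound _ (Nat.mod_lt _ two_pos) _ s hs.2
      _ = D * (16 * L) ^ (n % 2) * (2 * (n / 2)).factorial := by rw [← hcancel]; ring
      _ ≤ D * (1 + 16 * L) * n.factorial := by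
          gcongr
          exact Nat.mul_div_le n 2
  exact ⟨_, _, _, isClassicalSolution_egf hL hderiv
    (fun n => switchedTrace_of_le _ (by linarith)) hGbound, fun x _ => by simp only [hfinal]⟩

theorem factorial_le_sixteen_pow_mul (n : ℕ) :
    n.factorial ≤ 16 ^ (n / 2) * ((n / 2).factorial * (n / 2).factorial) := by
  set i := n / 2
  have hchoose : (2 * i + 1).factorial =
      (2 * i + 1) * ((i + i).choose i * i.factorial * i.factorial) := by
    rw [Nat.factorial_succ, Nat.add_choose_mul_factorial_mul_factorial, two_mul]
  calc n.factorial ≤ (2 * i + 1).factorial := Nat.factorial_le (by lia)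
    _ ≤ 2 ^ (2 * i) * (2 ^ (i + i) * i.factorial * i.factorial) := by
        rw [hchoose]
        gcongr
        · exact Nat.lt_two_pow_self
        · exact Nat.choose_le_two_pow _ _
    _ = (2 ^ 4) ^ i * (i.factorial * i.factorial) := by rw [← pow_mul]; ring
    _ = 16 ^ i * (i.factorial * i.factorial) := by norm_num

theorem factorial_half_le_sqrt_pow (n : ℕ) :
    ((n / 2).factorial : ℝ) ≤ Real.sqrt ((n / 2 : ℕ) + 1) ^ n := by
  set i := n / 2
  have hsq : Real.sqrt (i + 1) ^ 2 = i + 1 := Real.sq_sqrt (by positivity)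
  have hone : 1 ≤ Real.sqrt (i + 1) := by
    rw [Real.one_le_sqrt]
    linarith [i.cast_nonneg (α := ℝ)]
  calc (i.factorial : ℝ) ≤ (i + 1) ^ i := by
        exact_mod_cast (Nat.factorial_le_pow i).trans (Nat.pow_le_pow_left (Nat.le_succ i) i)
    _ = Real.sqrt (i + 1) ^ (2 * i) := by rw [pow_mul, hsq]
    _ ≤ _ := pow_le_pow_right₀ hone (by lia)

/- Cauchy's estimate on the circle of radius `√(n/2 + 1)`. -/
theorem norm_iteratedDeriv_le_of_gaussian {B : ℝ} {r : ℂ → ℂ} (hr : Differentiable ℂ r)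
    (hrB : ∀ ζ, ‖r ζ‖ ≤ C * Real.exp (B * ‖ζ‖ ^ 2)) (n : ℕ) :
    ‖iteratedDeriv n r 0‖ ≤
      C * Real.exp B * (16 * Real.exp B) ^ (n / 2) * (n / 2).factorial := by
  have hC : 0 ≤ C := by simpa using (norm_nonneg _).trans (hrB 0)
  have hradius : 0 < Real.sqrt ((n / 2 : ℕ) + 1) := by positivity
  have hcauchy := Complex.norm_iteratedDeriv_le_of_forall_mem_sphere_norm_le n hradius
    (f := r) (c := 0) (C := C * Real.exp (B * ((n / 2 : ℕ) + 1))) hr.diffContOnCl fun z hz => by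
      rw [← Real.sq_sqrt (by positivity : (0 : ℝ) ≤ (n / 2 : ℕ) + 1),
        ← mem_sphere_zero_iff_norm.1 hz]
      exact hrB z
  have hexp : Real.exp (B * ((n / 2 : ℕ) + 1)) = Real.exp B * Real.exp B ^ (n / 2) := by
    rw [← Real.exp_nat_mul, ← Real.exp_add]
    ring_nf
  refine hcauchy.trans ((div_le_iff₀ (by positivity)).2 ?_)
  calc n.factorial * (C * Real.exp (B * ((n / 2 : ℕ) + 1)))
      ≤ (16 ^ (n / 2) * ((n / 2).factorial * (n / 2).factorial)) *
          (C * Real.exp (B * ((n / 2 : ℕ) + 1))) := by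
        gcongr
        exact_mod_cast factorial_le_sixteen_pow_mul n
    _ = C * Real.exp B * (16 * Real.exp B) ^ (n / 2) * (n / 2).factorial * (n / 2).factorial := by
        rw [hexp, mul_pow]; ring
    _ ≤ _ := by gcongr; exact factorial_half_le_sqrt_pow n

theorem classicallyReachable_of_entire (hL : 0 < L) (hT : 0 < T) {B : ℝ} {r : ℂ → ℂ}
    (hr : Differentiable ℂ r) (hrB : ∀ ζ, ‖r ζ‖ ≤ C * Real.exp (B * ‖ζ‖ ^ 2)) :
    ClassicallyReachable L T (fun x => r x) := by
  refine (classicallyReachable_egf hL hT (by positivity)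
    (norm_iteratedDeriv_le_of_gaussian hr hrB)).congr fun x _ => ?_
  rw [← (Complex.hasSum_taylorSeries_of_entire hr 0 x).tsum_eq, egf]
  refine tsum_congr fun n => ?_
  rw [sub_zero, smul_eq_mul, smul_eq_mul]
  ring

end EntireState

/-- The profile `t^{-b} exp(-x² / 4t)`, extended by `0` to `t ≤ 0`. -/
def gaussProfile (b t x : ℝ) : ℝ :=
  if 0 < t then t ^ (-b) * Real.exp (-(x ^ 2 / 4 / t)) else 0

/-- Functions of `(t,x)` that vanish for `t ≤ 0`, are continuous off `x = 0`, and are `O(t²)` there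
at `t = 0⁺`, locally uniformly in `x`. The positive part of `t` encodes the vanishing for
`t ≤ 0`. -/
structure IsCausal (f : ℝ → ℝ → ℝ) : Prop where
  measurable : Measurable (Function.uncurry f)
  continuousOn : ContinuousOn (Function.uncurry f) {p | p.2 ≠ 0}
  exists_abs_le : ∀ δ R, 0 < δ → ∃ C, 0 ≤ C ∧
    ∀ t x, δ ≤ |x| → |x| ≤ R → |f t x| ≤ C * max t 0 ^ 2

/-- Solutions `κ` of the heat equation off `x = 0` that vanish for `t ≤ 0`, with their derivatives
`κt = ∂ₜκ` and `κx = ∂ₓκ`. -/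
structure IsCausalKernel (κ κt κx : ℝ → ℝ → ℝ) : Prop where
  isCausal : IsCausal κ
  isCausal_dt : IsCausal κt
  isCausal_dx : IsCausal κx
  hasDerivAt_dt : ∀ t x, x ≠ 0 → HasDerivAt (fun t => κ t x) (κt t x) t
  hasDerivAt_dx : ∀ t x, x ≠ 0 → HasDerivAt (κ t) (κx t x) x
  hasDerivAt_dxx : ∀ t x, x ≠ 0 → HasDerivAt (κx t) (κt t x) x

section GaussProfile

variable {b t x : ℝ}

theorem gaussProfile_of_nonpos (b x : ℝ) (ht : t ≤ 0) : gaussProfile b t x = 0 :=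
  if_neg ht.not_gt

theorem gaussProfile_of_pos (b x : ℝ) (ht : 0 < t) :
    gaussProfile b t x = t ^ (-b) * Real.exp (-(x ^ 2 / 4 / t)) := if_pos ht

theorem gaussProfile_nonneg (b t x : ℝ) : 0 ≤ gaussProfile b t x := by
  unfold gaussProfile
  split_ifs with h <;> positivity

theorem rpow_neg_le_one_add (hb : 0 ≤ b) (ht : 0 < t) {n : ℕ} (hn : b ≤ n) :
    t ^ (-b) ≤ 1 + 1 / t ^ n := by
  rcases le_or_gt 1 t with h | h
  · have : t ^ (-b) ≤ 1 := Real.rpow_le_one_of_one_le_of_nonpos h (by linarith)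
    linarith [show 0 ≤ 1 / t ^ n by positivity]
  · have : t ^ (-b) ≤ t ^ (-(n : ℝ)) := Real.rpow_le_rpow_of_exponent_ge ht h.le (by linarith)
    rw [Real.rpow_neg ht.le n, Real.rpow_natCast, ← one_div] at this
    linarith

theorem exists_gaussProfile_le {δ : ℝ} (hb : 0 ≤ b) (hδ : 0 < δ) :
    ∃ C, 0 ≤ C ∧ ∀ t x, δ ≤ |x| → gaussProfile b t x ≤ C * max t 0 ^ 2 := by
  obtain ⟨n, hn⟩ := exists_nat_ge b
  have ha : 0 < δ ^ 2 / 4 := by positivity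
  refine ⟨(0 + 2).factorial / (δ ^ 2 / 4) ^ (0 + 2) + (n + 2).factorial / (δ ^ 2 / 4) ^ (n + 2),
    by positivity, fun t x hx => ?_⟩
  rcases le_or_gt t 0 with ht | ht
  · rw [gaussProfile_of_nonpos b x ht]
    positivity
  have hx2 : δ ^ 2 ≤ x ^ 2 := by
    rw [← sq_abs x]
    gcongr
  have h0 := pow_mul_exp_neg_le ha 0 2 ht
  have hn' := pow_mul_exp_neg_le ha n 2 ht
  rw [gaussProfile_of_pos b x ht, max_eq_left ht.le]
  calc t ^ (-b) * Real.exp (-(x ^ 2 / 4 / t))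
      ≤ (1 + 1 / t ^ n) * Real.exp (-(δ ^ 2 / 4 / t)) := by
        gcongr
        exact rpow_neg_le_one_add hb ht hn
    _ = Real.exp (-(δ ^ 2 / 4 / t)) / t ^ 0 + Real.exp (-(δ ^ 2 / 4 / t)) / t ^ n := by ring
    _ ≤ _ := by linarith

theorem continuousAt_gaussProfile_zero (hb : 0 ≤ b) (hx : x ≠ 0) :
    ContinuousAt (Function.uncurry (gaussProfile b)) (0, x) := by
  obtain ⟨C, -, hC⟩ := exists_gaussProfile_le hb (half_pos (abs_pos.2 hx))
  have hlim : Filter.Tendsto (fun p : ℝ × ℝ => C * max p.1 0 ^ 2) (nhds (0, x)) (nhds 0) := by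
    simpa using (by fun_prop : Continuous fun p : ℝ × ℝ => C * max p.1 0 ^ 2).tendsto (0, x)
  have hopen : IsOpen {p : ℝ × ℝ | |x| / 2 < |p.2|} := isOpen_lt continuous_const (by fun_prop)
  rw [ContinuousAt, Function.uncurry_apply_pair, gaussProfile_of_nonpos b x le_rfl]
  refine squeeze_zero' (.of_forall fun p => gaussProfile_nonneg _ _ _) ?_ hlim
  filter_upwards [hopen.mem_nhds (half_lt_self (abs_pos.2 hx))] with p hp
  exact hC p.1 p.2 (le_of_lt hp)

theorem continuousOn_gaussProfile (hb : 0 ≤ b) :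
    ContinuousOn (Function.uncurry (gaussProfile b)) {p | p.2 ≠ 0} := by
  rintro ⟨t, x⟩ (hx : x ≠ 0)
  refine ContinuousAt.continuousWithinAt ?_
  rcases lt_trichotomy 0 t with ht | rfl | ht
  · have hcont : ContinuousAt
        (fun p : ℝ × ℝ => p.1 ^ (-b) * Real.exp (-(p.2 ^ 2 / 4 / p.1))) (t, x) :=
      (continuousAt_fst.rpow_const (.inl ht.ne')).mul
        (ContinuousAt.div (by fun_prop) continuousAt_fst ht.ne').neg.rexp
    refine hcont.congr ?_
    filter_upwards [continuousAt_fst.eventually_const_lt ht] with p hp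
    exact (gaussProfile_of_pos b p.2 hp).symm
  · exact continuousAt_gaussProfile_zero hb hx
  · refine (continuousAt_const (y := (0 : ℝ))).congr ?_
    filter_upwards [continuousAt_fst.eventually_lt_const ht] with p hp
    exact (gaussProfile_of_nonpos b p.2 (le_of_lt hp)).symm

theorem hasDerivAt_gaussProfile_dx (b t x : ℝ) :
    HasDerivAt (gaussProfile b t) (-(x / 2) * gaussProfile (b + 1) t x) x := by
  rcases le_or_gt t 0 with ht | ht
  · rw [show gaussProfile b t = fun _ => 0 from funext fun x => gaussProfile_of_nonpos b x ht,
      gaussProfile_of_nonpos _ x ht, mul_zero]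
    exact hasDerivAt_const x 0
  · have hexponent : HasDerivAt (fun x : ℝ => -(x ^ 2 / 4 / t)) (-(x / 2) / t) x := by
      refine (((hasDerivAt_pow 2 x).div_const 4).div_const t).neg.congr_deriv ?_
      field_simp
      ring
    rw [show gaussProfile b t = fun x => t ^ (-b) * Real.exp (-(x ^ 2 / 4 / t)) from
      funext fun x => gaussProfile_of_pos b x ht]
    refine (hexponent.exp.const_mul _).congr_deriv ?_
    rw [gaussProfile_of_pos _ x ht, neg_add, ← sub_eq_add_neg, Real.rpow_sub_one ht.ne']
    ring

theorem hasDerivAt_gaussProfile_dt_of_pos (b x : ℝ) (ht : 0 < t) :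
    HasDerivAt (fun t => gaussProfile b t x)
      (-b * gaussProfile (b + 1) t x + x ^ 2 / 4 * gaussProfile (b + 2) t x) t := by
  have hexponent : HasDerivAt (fun t : ℝ => -(x ^ 2 / 4 / t)) (x ^ 2 / 4 / t ^ 2) t := by
    refine ((hasDerivAt_inv ht.ne').const_mul (x ^ 2 / 4)).neg.congr_deriv ?_
    field_simp
  have hderiv := ((Real.hasDerivAt_rpow_const (p := -b) (.inl ht.ne')).mul
    hexponent.exp).congr_of_eventuallyEq (f₁ := fun t => gaussProfile b t x) (by
      filter_upwards [lt_mem_nhds ht] with r hr using gaussProfile_of_pos b x hr)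
  refine hderiv.congr_deriv ?_
  rw [gaussProfile_of_pos _ x ht, gaussProfile_of_pos _ x ht, neg_add, neg_add, ← sub_eq_add_neg,
    ← sub_eq_add_neg, Real.rpow_sub ht (-b) 2, Real.rpow_two]
  ring

theorem hasDerivAt_gaussProfile_dt (hb : 0 ≤ b) (t : ℝ) (hx : x ≠ 0) :
    HasDerivAt (fun t => gaussProfile b t x)
      (-b * gaussProfile (b + 1) t x + x ^ 2 / 4 * gaussProfile (b + 2) t x) t := by
  rcases lt_or_ge 0 t with ht | ht
  · exact hasDerivAt_gaussProfile_dt_of_pos b x ht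
  rw [gaussProfile_of_nonpos _ x ht, gaussProfile_of_nonpos _ x ht, mul_zero, mul_zero, add_zero]
  rcases ht.lt_or_eq with ht | rfl
  · refine (hasDerivAt_const t (0 : ℝ)).congr_of_eventuallyEq ?_
    filter_upwards [gt_mem_nhds ht] with r hr using gaussProfile_of_nonpos b x hr.le
  · obtain ⟨C, hC0, hC⟩ := exists_gaussProfile_le hb (abs_pos.2 hx)
    have hO : (fun t => gaussProfile b t x) =O[nhds 0] fun t : ℝ => ‖t - 0‖ ^ 2 := by
      refine .of_bound C (.of_forall fun t => ?_)
      rw [Real.norm_of_nonneg (gaussProfile_nonneg _ _ _), sub_zero, norm_pow, norm_norm]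
      refine (hC t x le_rfl).trans ?_
      gcongr
      exact max_le (le_abs_self t) (abs_nonneg t)
    simpa using (hO.hasFDerivAt one_lt_two).hasDerivAt

end GaussProfile

namespace IsCausal

variable {f g : ℝ → ℝ → ℝ}

theorem gaussProfile {b : ℝ} (hb : 0 ≤ b) : IsCausal (gaussProfile b) where
  measurable := Measurable.ite (measurableSet_lt measurable_const measurable_fst) (by fun_prop)
    measurable_const
  continuousOn := continuousOn_gaussProfile hb
  exists_abs_le δ R hδ := by
    obtain ⟨C, hC0, hC⟩ := exists_gaussProfile_le hb hδ
    refine ⟨C, hC0, fun t x hx _ => ?_⟩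
    rw [abs_of_nonneg (gaussProfile_nonneg _ _ _)]
    exact hC t x hx

theorem add (hf : IsCausal f) (hg : IsCausal g) : IsCausal fun t x => f t x + g t x where
  measurable := hf.measurable.add hg.measurable
  continuousOn := hf.continuousOn.add hg.continuousOn
  exists_abs_le δ R hδ := by
    obtain ⟨C, hC0, hC⟩ := hf.exists_abs_le δ R hδ
    obtain ⟨D, hD0, hD⟩ := hg.exists_abs_le δ R hδ
    refine ⟨C + D, by positivity, fun t x hx hxR => ?_⟩
    rw [add_mul]
    exact (abs_add_le _ _).trans (add_le_add (hC t x hx hxR) (hD t x hx hxR))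

theorem space_mul {p : ℝ → ℝ} (hp : Continuous p) (hf : IsCausal f) :
    IsCausal fun t x => p x * f t x where
  measurable := (hp.measurable.comp measurable_snd).mul hf.measurable
  continuousOn := (hp.comp continuous_snd).continuousOn.mul hf.continuousOn
  exists_abs_le δ R hδ := by
    obtain ⟨C, hC0, hC⟩ := hf.exists_abs_le δ R hδ
    obtain ⟨D, hD⟩ := isCompact_Icc.exists_bound_of_continuousOn (s := Icc (-R) R) hp.continuousOn
    refine ⟨|D| * C, by positivity, fun t x hx hxR => ?_⟩
    rw [abs_mul, mul_assoc]
    exact mul_le_mul ((hD x (abs_le.1 hxR)).trans (le_abs_self D)) (hC t x hx hxR) (abs_nonneg _)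
      (abs_nonneg _)

theorem eq_zero_of_nonpos (hf : IsCausal f) {t x : ℝ} (ht : t ≤ 0) (hx : x ≠ 0) : f t x = 0 := by
  obtain ⟨C, -, hC⟩ := hf.exists_abs_le |x| |x| (abs_pos.2 hx)
  simpa [max_eq_right ht] using hC t x le_rfl le_rfl

theorem exists_abs_translate_le (hf : IsCausal f) {L z : ℝ} (hz : L < |z|) :
    ∃ C, 0 ≤ C ∧ ∀ r t x, r ≤ t → 0 ≤ t → |x| ≤ L → |f r (x - z)| ≤ C * t ^ 2 := by
  obtain ⟨C, hC0, hC⟩ := hf.exists_abs_le (|z| - L) (L + |z|) (by linarith)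
  refine ⟨C, hC0, fun r t x hr ht hx => ?_⟩
  have hfar : |z| - L ≤ |x - z| := by
    rw [abs_sub_comm]
    linarith [abs_sub_abs_le_abs_sub z x]
  refine (hC _ _ hfar ((abs_sub _ _).trans (by gcongr))).trans ?_
  gcongr
  exact max_le hr ht

end IsCausal

namespace IsCausalKernel

theorem monopole : IsCausalKernel (gaussProfile (1 / 2))
    (fun t x => -(1 / 2) * gaussProfile (3 / 2) t x + x ^ 2 / 4 * gaussProfile (5 / 2) t x)
    (fun t x => -(x / 2) * gaussProfile (3 / 2) t x) where
  isCausal := .gaussProfile (by norm_num)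
  isCausal_dt := .add (.space_mul continuous_const (.gaussProfile (by norm_num)))
    (.space_mul (by fun_prop) (.gaussProfile (by norm_num)))
  isCausal_dx := .space_mul (by fun_prop) (.gaussProfile (by norm_num))
  hasDerivAt_dt t x hx := by
    refine (hasDerivAt_gaussProfile_dt (by norm_num) t hx).congr_deriv ?_
    norm_num
  hasDerivAt_dx t x _ := by
    refine (hasDerivAt_gaussProfile_dx (1 / 2) t x).congr_deriv ?_
    norm_num
  hasDerivAt_dxx t x _ := by
    refine (((hasDerivAt_id x).div_const 2).neg.mul
      (hasDerivAt_gaussProfile_dx (3 / 2) t x)).congr_deriv ?_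
    norm_num
    ring

theorem dipole : IsCausalKernel (fun t x => x * gaussProfile (3 / 2) t x)
    (fun t x => x * (-(3 / 2) * gaussProfile (5 / 2) t x + x ^ 2 / 4 * gaussProfile (7 / 2) t x))
    (fun t x => gaussProfile (3 / 2) t x + -(x ^ 2 / 2) * gaussProfile (5 / 2) t x) where
  isCausal := .space_mul continuous_id (.gaussProfile (by norm_num))
  isCausal_dt := .space_mul continuous_id
    (.add (.space_mul continuous_const (.gaussProfile (by norm_num)))
      (.space_mul (by fun_prop) (.gaussProfile (by norm_num))))
  isCausal_dx := .add (.gaussProfile (by norm_num))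
    (.space_mul (by fun_prop) (.gaussProfile (by norm_num)))
  hasDerivAt_dt t x hx := by
    refine ((hasDerivAt_gaussProfile_dt (b := 3 / 2) (by norm_num) t hx).const_mul x).congr_deriv ?_
    norm_num
  hasDerivAt_dx t x _ := by
    refine ((hasDerivAt_id x).mul (hasDerivAt_gaussProfile_dx (3 / 2) t x)).congr_deriv ?_
    norm_num
    ring
  hasDerivAt_dxx t x _ := by
    refine ((hasDerivAt_gaussProfile_dx (3 / 2) t x).add (((hasDerivAt_pow 2 x).div_const 2).neg.mul
      (hasDerivAt_gaussProfile_dx (5 / 2) t x))).congr_deriv ?_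
    norm_num
    ring

variable {κ κt κx : ℝ → ℝ → ℝ} {L T z : ℝ}

theorem isClassicalSolution_translate (hκ : IsCausalKernel κ κt κx) (hz : L < |z|) {d : ℝ}
    (hd : 0 ≤ d) (q : ℂ) : IsClassicalSolution L T (fun s x => q * (κ (s - d) (x - z) : ℝ))
      (fun s x => q * (κt (s - d) (x - z) : ℝ)) (fun s x => q * (κx (s - d) (x - z) : ℝ)) := by
  have hne : ∀ x ∈ Icc (-L) L, x - z ≠ 0 := fun x hx h =>
    hz.not_ge (by rw [← sub_eq_zero.1 h]; exact abs_le.2 hx)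
  have hcont : ∀ f, IsCausal f → ContinuousOn
      (fun p : ℝ × ℝ => q * (f (p.1 - d) (p.2 - z) : ℝ)) (Icc 0 T ×ˢ Icc (-L) L) := fun f hf =>
    continuousOn_const.mul (Complex.continuous_ofReal.comp_continuousOn
      (hf.continuousOn.comp
        (by fun_prop : Continuous fun p : ℝ × ℝ => (p.1 - d, p.2 - z)).continuousOn
        fun p hp => hne p.2 hp.2))
  refine ⟨hcont κ hκ.isCausal, hcont κt hκ.isCausal_dt, hcont κx hκ.isCausal_dx,
    fun s _ x hx => ?_, fun s _ x hx => ?_, fun s _ x hx => ?_, fun x hx => ?_⟩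
  · exact ((hκ.hasDerivAt_dt (s - d) (x - z)
      (hne x (Ioo_subset_Icc_self hx))).comp_sub_const s d).ofReal_comp.const_mul q
  · exact ((hκ.hasDerivAt_dx (s - d) (x - z)
      (hne x (Ioo_subset_Icc_self hx))).comp_sub_const x z).ofReal_comp.const_mul q
  · exact ((hκ.hasDerivAt_dxx (s - d) (x - z)
      (hne x (Ioo_subset_Icc_self hx))).comp_sub_const x z).ofReal_comp.const_mul q
  · rw [hκ.isCausal.eq_zero_of_nonpos (by linarith) (hne x hx), Complex.ofReal_zero, mul_zero]

/- The source `θ` at `z` is switched on at time `T - t θ`. -/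
theorem classicallyReachable_integral (hκ : IsCausalKernel κ κt κx) (hz : L < |z|)
    {Ω : Type*} [MeasurableSpace Ω] {ν : Measure Ω} {σ : Ω → ℂ} {t : Ω → ℝ}
    (hσ : AEStronglyMeasurable σ ν) (ht : Measurable t) (htT : ∀ᵐ θ ∂ν, t θ ∈ Ioc 0 T)
    (hσt : Integrable (fun θ => σ θ * (t θ : ℂ) ^ 2) ν) :
    ClassicallyReachable L T fun x => ∫ θ, σ θ * (κ (t θ) (x - z) : ℝ) ∂ν := by
  have hmeas : ∀ f, IsCausal f → ∀ s x, AEStronglyMeasurable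
      (fun θ => σ θ * (f (s - (T - t θ)) (x - z) : ℝ)) ν := fun f hf s x =>
    hσ.mul (Complex.measurable_ofReal.comp (hf.measurable.comp
      (by fun_prop : Measurable fun θ => (s - (T - t θ), x - z)))).aestronglyMeasurable
  have hbound : ∀ f, IsCausal f → ∃ C, 0 ≤ C ∧ ∀ᵐ θ ∂ν, ∀ s ∈ Icc 0 T, ∀ x ∈ Icc (-L) L,
      ‖σ θ * (f (s - (T - t θ)) (x - z) : ℝ)‖ ≤ C * ‖σ θ * (t θ : ℂ) ^ 2‖ := by
    intro f hf
    obtain ⟨C, hC0, hC⟩ := hf.exists_abs_translate_le hz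
    refine ⟨C, hC0, htT.mono fun θ hθ s hs x hx => ?_⟩
    rw [norm_mul, norm_mul, Complex.norm_real, norm_pow, Complex.norm_real, Real.norm_eq_abs,
      Real.norm_of_nonneg hθ.1.le, mul_left_comm]
    gcongr
    exact hC _ _ x (by linarith [hs.2]) hθ.1.le (abs_le.2 hx)
  obtain ⟨C, hC0, hC⟩ := hbound κ hκ.isCausal
  obtain ⟨Ct, hCt0, hCt⟩ := hbound κt hκ.isCausal_dt
  obtain ⟨Cx, hCx0, hCx⟩ := hbound κx hκ.isCausal_dx
  refine ⟨_, _, _, .integral (hmeas κ hκ.isCausal) (hmeas κt hκ.isCausal_dt)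
    (hmeas κx hκ.isCausal_dx) (hσt.norm.const_mul (C + Ct + Cx)) ?_ (htT.mono fun θ hθ =>
      hκ.isClassicalSolution_translate hz (sub_nonneg.2 hθ.2) (σ θ)), fun x _ => by simp⟩
  filter_upwards [hC, hCt, hCx] with θ h ht hx s hs x hxL
  refine ⟨(h s hs x hxL).trans ?_, (ht s hs x hxL).trans ?_, (hx s hs x hxL).trans ?_⟩ <;>
    gcongr <;> linarith

end IsCausalKernel

section TimeIntegral

variable {A : ℂ} {T : ℝ}

theorem rpow_smul_exp_eq {t : ℝ} (ht : 0 < t) :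
    (|(-1 : ℝ)| * t ^ ((-1 : ℝ) - 1)) • Complex.exp (-(A / 4) * (t ^ (-1 : ℝ) : ℝ)) =
      ((t : ℂ) ^ 2)⁻¹ * Complex.exp (-(A / (4 * t))) := by
  rw [show (-1 : ℝ) - 1 = -(2 : ℕ) by norm_num, Real.rpow_neg ht.le, Real.rpow_natCast,
    Real.rpow_neg_one, abs_neg, abs_one, one_mul, Complex.real_smul]
  push_cast
  congr 2
  field_simp

theorem integrableOn_inv_sq_mul_exp (hA : 0 < A.re) :
    IntegrableOn (fun t : ℝ => ((t : ℂ) ^ 2)⁻¹ * Complex.exp (-(A / (4 * t)))) (Ioi 0) := by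
  have h : (-(A / 4)).re < 0 := by simpa using hA
  exact ((integrableOn_Ioi_comp_rpow_iff _ (neg_ne_zero.2 one_ne_zero)).2
    (integrableOn_exp_mul_complex_Ioi h 0)).congr_fun (fun t ht => rpow_smul_exp_eq ht)
    measurableSet_Ioi

theorem integral_Ioi_inv_sq_mul_exp (hA : 0 < A.re) :
    ∫ t in Ioi (0 : ℝ), ((t : ℂ) ^ 2)⁻¹ * Complex.exp (-(A / (4 * t))) = 4 / A := by
  have h : (-(A / 4)).re < 0 := by simpa using hA
  rw [← setIntegral_congr_fun measurableSet_Ioi fun t ht => rpow_smul_exp_eq ht,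
    integral_comp_rpow_Ioi (fun y : ℝ => Complex.exp (-(A / 4) * y)) (neg_ne_zero.2 one_ne_zero),
    integral_exp_mul_complex_Ioi h]
  simp

theorem hasDerivAt_exp_neg_div (hA : A ≠ 0) {t : ℝ} (ht : t ≠ 0) :
    HasDerivAt (fun t : ℝ => 4 / A * Complex.exp (-(A / (4 * t))))
      (((t : ℂ) ^ 2)⁻¹ * Complex.exp (-(A / (4 * t)))) t := by
  have ht' : (t : ℂ) ≠ 0 := Complex.ofReal_ne_zero.2 ht
  have hexponent : HasDerivAt (fun z : ℂ => -(A / (4 * z))) (A / 4 * ((t : ℂ) ^ 2)⁻¹) t := by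
    have := ((hasDerivAt_inv ht').const_mul (-(A / 4)))
    refine (this.congr_of_eventuallyEq (.of_forall fun z => ?_)).congr_deriv (by ring)
    simp only [div_eq_mul_inv, mul_inv]
    ring
  refine ((hexponent.cexp.const_mul (4 / A)).comp_ofReal).congr_deriv ?_
  field_simp

theorem integral_Ioo_inv_sq_mul_exp (hA : 0 < A.re) (hT : 0 < T) :
    ∫ t in Ioo (0 : ℝ) T, ((t : ℂ) ^ 2)⁻¹ * Complex.exp (-(A / (4 * t))) =
      4 / A * Complex.exp (-(A / (4 * T))) := by
  have hA0 : A ≠ 0 := fun h => by simp [h] at hA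
  have hint := integrableOn_inv_sq_mul_exp hA
  have hlim : Filter.Tendsto (fun t : ℝ => 4 / A * Complex.exp (-(A / (4 * t)))) Filter.atTop
      (nhds (4 / A)) := by
    have hinv : Filter.Tendsto (fun t : ℝ => -(A / 4 * ((t⁻¹ : ℝ) : ℂ))) Filter.atTop (nhds 0) := by
      have := ((Complex.continuous_ofReal.tendsto 0).comp tendsto_inv_atTop_zero).const_mul (A / 4)
      simpa using this.neg
    have := (Complex.continuous_exp.tendsto 0).comp hinv
    refine (by simpa using this.const_mul (4 / A) : Filter.Tendsto _ _ _).congr fun t => ?_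
    rw [← div_eq_mul_inv, div_div]
  have htail := integral_Ioi_of_hasDerivAt_of_tendsto'
    (fun t ht => hasDerivAt_exp_neg_div hA0 (hT.trans_le ht).ne')
    (hint.mono_set (Ioi_subset_Ioi hT.le)) hlim
  have hsplit := setIntegral_union (Ioc_disjoint_Ioi le_rfl) measurableSet_Ioi
    (hint.mono_set Ioc_subset_Ioi_self) (hint.mono_set (Ioi_subset_Ioi hT.le))
  rw [Ioc_union_Ioi_eq_Ioi hT.le, integral_Ioi_inv_sq_mul_exp hA, htail] at hsplit
  rw [← integral_Ioc_eq_integral_Ioo]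
  linear_combination -hsplit

end TimeIntegral

section Truncation

variable {Y : Type*} [MeasurableSpace Y] {m : Measure Y} {β c : Y → ℂ} {L T X a b : ℝ}

theorem rpow_mul_exp_mul_gaussProfile (c : ℂ) (X : ℝ) (hab : a + b = 2) {t : ℝ} (ht : 0 < t) :
    ((t ^ (-a) : ℝ) : ℂ) * Complex.exp (-(c / (4 * t))) * (gaussProfile b t X : ℂ) =
      ((t : ℂ) ^ 2)⁻¹ * Complex.exp (-(((X : ℂ) ^ 2 + c) / (4 * t))) := by
  have hpow : t ^ (-a) * t ^ (-b) = (t ^ 2)⁻¹ := by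
    rw [← Real.rpow_add ht, ← neg_add, hab, Real.rpow_neg ht.le, Real.rpow_two]
  have hexp : -(((X : ℂ) ^ 2 + c) / (4 * t)) = -(c / (4 * t)) + ((-(X ^ 2 / 4 / t) : ℝ) : ℂ) := by
    push_cast
    ring
  rw [gaussProfile_of_pos b X ht, hexp, Complex.exp_add, ← Complex.ofReal_exp, ← Complex.ofReal_pow,
    ← Complex.ofReal_inv, ← hpow]
  push_cast
  ring

theorem norm_exp_neg_div_le_one {A : ℂ} (hA : 0 ≤ A.re) {t : ℝ} (ht : 0 ≤ t) :
    ‖Complex.exp (-(A / (4 * t)))‖ ≤ 1 := by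
  have : (A / (4 * t)).re = A.re / (4 * t) := by exact_mod_cast Complex.div_ofReal_re A (4 * t)
  rw [Complex.norm_exp, Complex.neg_re, this, Real.exp_le_one_iff, neg_nonpos]
  positivity

theorem integrable_mul_four_div_mul_exp (hβ : Integrable β m) (hc : AEStronglyMeasurable c m)
    (hre : ∀ᵐ y ∂m, 0 ≤ (c y).re) (hT : 0 ≤ T) (hX : X ≠ 0) (w : ℂ) :
    Integrable (fun y => β y * (w * (4 / ((X : ℂ) ^ 2 + c y) *
      Complex.exp (-(((X : ℂ) ^ 2 + c y) / (4 * T)))))) m := by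
  have hcm := hc.aemeasurable
  refine hβ.mul_bdd (c := ‖w‖ * (4 / X ^ 2 * 1))
    (AEMeasurable.aestronglyMeasurable (by fun_prop)) ?_
  filter_upwards [hre] with y hy
  have hA : X ^ 2 ≤ ((X : ℂ) ^ 2 + c y).re := by
    rw [Complex.add_re, ← Complex.ofReal_pow, Complex.ofReal_re]
    linarith
  rw [norm_mul, norm_mul, norm_div, Complex.norm_ofNat]
  gcongr
  · exact hA.trans (Complex.re_le_norm _)
  · exact norm_exp_neg_div_le_one ((sq_nonneg X).trans hA) hT

theorem integral_Ioo_rpow_mul_exp_mul_gaussProfile {c : ℂ} (hab : a + b = 2) (hT : 0 < T)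
    (hX : X ≠ 0) (hc : 0 ≤ c.re) :
    ∫ t in Ioo 0 T, ((t ^ (-a) : ℝ) : ℂ) * Complex.exp (-(c / (4 * t))) * gaussProfile b t X =
      4 / ((X : ℂ) ^ 2 + c) * Complex.exp (-(((X : ℂ) ^ 2 + c) / (4 * T))) := by
  rw [setIntegral_congr_fun measurableSet_Ioo fun t ht =>
    rpow_mul_exp_mul_gaussProfile c X hab ht.1]
  refine integral_Ioo_inv_sq_mul_exp ?_ hT
  rw [Complex.add_re, ← Complex.ofReal_pow, Complex.ofReal_re]
  positivity

theorem aestronglyMeasurable_prod_mul_rpow_mul_exp [SFinite m] {ν : Measure ℝ} [SFinite ν]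
    (hβ : AEStronglyMeasurable β m) (hc : AEStronglyMeasurable c m) (a : ℝ) :
    AEStronglyMeasurable (fun θ : Y × ℝ =>
      β θ.1 * (((θ.2 ^ (-a) : ℝ) : ℂ) * Complex.exp (-(c θ.1 / (4 * θ.2))))) (m.prod ν) := by
  have : AEMeasurable (fun θ : Y × ℝ => c θ.1) (m.prod ν) := hc.comp_fst.aemeasurable
  exact hβ.comp_fst.mul (AEMeasurable.aestronglyMeasurable (by fun_prop))

theorem integrable_prod_mul_rpow_mul_exp_mul_sq [SFinite m] (hab : a + b = 2) (hb : 0 ≤ b)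
    (hβ : Integrable β m) (hc : AEStronglyMeasurable c m) (hre : ∀ᵐ y ∂m, 0 ≤ (c y).re) :
    Integrable (fun θ : Y × ℝ => β θ.1 * (((θ.2 ^ (-a) : ℝ) : ℂ) *
      Complex.exp (-(c θ.1 / (4 * θ.2)))) * (θ.2 : ℂ) ^ 2)
      (m.prod (volume.restrict (Ioo 0 T))) := by
  refine (hβ.norm.mul_prod (integrable_const (T ^ b))).mono'
    ((aestronglyMeasurable_prod_mul_rpow_mul_exp hβ.aestronglyMeasurable hc a).mul
      (by fun_prop : Measurable fun θ : Y × ℝ => (θ.2 : ℂ) ^ 2).aestronglyMeasurable) ?_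
  filter_upwards [Measure.quasiMeasurePreserving_snd.ae (ae_restrict_mem measurableSet_Ioo),
    Measure.quasiMeasurePreserving_fst.ae hre] with θ ht hθ
  have hpow : θ.2 ^ (-a) * θ.2 ^ 2 = θ.2 ^ b := by
    rw [← Real.rpow_two, ← Real.rpow_add ht.1, ← hab, neg_add_cancel_left]
  calc ‖β θ.1 * (((θ.2 ^ (-a) : ℝ) : ℂ) * Complex.exp (-(c θ.1 / (4 * θ.2)))) * (θ.2 : ℂ) ^ 2‖
      = ‖β θ.1‖ * (θ.2 ^ (-a) * θ.2 ^ 2 * ‖Complex.exp (-(c θ.1 / (4 * θ.2)))‖) := by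
        simp only [norm_mul, norm_pow, Complex.norm_real,
          Real.norm_of_nonneg (Real.rpow_nonneg ht.1.le _), Real.norm_of_nonneg ht.1.le]
        ring
    _ ≤ ‖β θ.1‖ * (T ^ b * 1) := by
        rw [hpow]
        gcongr
        exacts [Real.rpow_nonneg (ht.1.trans ht.2).le _, ht.1.le, ht.2.le,
          norm_exp_neg_div_le_one hθ ht.1.le]
    _ = ‖β θ.1‖ * T ^ b := by rw [mul_one]

/- The sources at `z` are switched on during `(0,T)`, and those that act at time `T - t` have
intensity `t ^ (-a) * exp (-c y / 4t)`. -/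
theorem IsCausalKernel.classicallyReachable_truncated [SFinite m] {κ κt κx : ℝ → ℝ → ℝ}
    {w : ℝ → ℝ} {z : ℝ} (hκ : IsCausalKernel κ κt κx)
    (hform : ∀ t x, κ t x = w x * gaussProfile b t x) (hab : a + b = 2) (hb : 0 ≤ b)
    (hT : 0 < T) (hz : L < |z|) (hβ : Integrable β m) (hc : AEStronglyMeasurable c m)
    (hre : ∀ᵐ y ∂m, 0 ≤ (c y).re) :
    ClassicallyReachable L T fun x => ∫ y, β y * (w (x - z) *
      (4 / (((x - z : ℝ) : ℂ) ^ 2 + c y) *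
        Complex.exp (-((((x - z : ℝ) : ℂ) ^ 2 + c y) / (4 * T))))) ∂m := by
  have hmem : ∀ᵐ θ ∂m.prod (volume.restrict (Ioo 0 T)), θ.2 ∈ Ioo 0 T :=
    Measure.quasiMeasurePreserving_snd.ae (ae_restrict_mem measurableSet_Ioo)
  have hσ := aestronglyMeasurable_prod_mul_rpow_mul_exp (ν := volume.restrict (Ioo 0 T))
    hβ.aestronglyMeasurable hc a
  have hσt := integrable_prod_mul_rpow_mul_exp_mul_sq (T := T) hab hb hβ hc hre
  refine (hκ.classicallyReachable_integral hz hσ measurable_snd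
    (hmem.mono fun _ h => Ioo_subset_Ioc_self h) hσt).congr fun x hx => ?_
  have hxL : |x| < L := abs_lt.2 hx
  have hX : x - z ≠ 0 := by
    rintro h
    exact (hxL.trans hz).ne (by rw [sub_eq_zero.1 h])
  rw [integral_prod]
  · refine integral_congr_ae (hre.mono fun y hy => ?_)
    dsimp only
    rw [← integral_Ioo_rpow_mul_exp_mul_gaussProfile hab hT hX hy, ← integral_const_mul,
      ← integral_const_mul]
    congr 1 with t
    rw [hform]
    push_cast
    ring
  · obtain ⟨C, -, hC⟩ := hκ.isCausal.exists_abs_translate_le hz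
    refine (hσt.norm.const_mul C).mono' (hσ.mul (Complex.measurable_ofReal.comp
      (hκ.isCausal.measurable.comp
        (by fun_prop : Measurable fun θ : Y × ℝ => (θ.2, x - z)))).aestronglyMeasurable) ?_
    filter_upwards [hmem] with θ hθ
    rw [norm_mul, norm_mul _ ((θ.2 : ℂ) ^ 2), norm_pow, Complex.norm_real, Complex.norm_real,
      Real.norm_of_nonneg hθ.1.le, mul_left_comm C, Real.norm_eq_abs]
    gcongr
    exact hC _ _ x le_rfl hθ.1.le hxL.le

end Truncation

section Holomorphic

variable {Y : Type*} [MeasurableSpace Y] {m : Measure Y}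

theorem aestronglyMeasurable_deriv_of_hasDerivAt {F : ℂ → Y → ℂ} {F' : Y → ℂ} {ζ : ℂ}
    (hF : ∀ᶠ w in nhds ζ, AEStronglyMeasurable (F w) m)
    (hder : ∀ᵐ y ∂m, HasDerivAt (fun w => F w y) (F' y) ζ) : AEStronglyMeasurable F' m := by
  obtain ⟨w, hw, hFw⟩ :=
    Filter.exists_seq_forall_of_frequently
      (hF.filter_mono (nhdsWithin_le_nhds (s := {ζ}ᶜ))).frequently
  have hmeas : ∀ n, AEStronglyMeasurable (fun y => slope (fun w => F w y) ζ (w n)) m := fun n =>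
    ((hFw n).sub hF.self_of_nhds).const_smul (w n - ζ)⁻¹
  exact aestronglyMeasurable_of_tendsto_ae Filter.atTop hmeas
    (hder.mono fun y hy => (hasDerivAt_iff_tendsto_slope.1 hy).comp hw)

theorem differentiableOn_integral_of_isOpen {F : ℂ → Y → ℂ} {U : Set ℂ} (hU : IsOpen U)
    (hF : ∀ ζ ∈ U, AEStronglyMeasurable (F ζ) m)
    (hd : ∀ᵐ y ∂m, DifferentiableOn ℂ (fun ζ => F ζ y) U)
    (hb : ∀ ζ ∈ U, ∃ V ∈ nhds ζ, ∃ g : Y → ℝ, Integrable g m ∧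
      ∀ᵐ y ∂m, ∀ w ∈ V, ‖F w y‖ ≤ g y) :
    DifferentiableOn ℂ (fun ζ => ∫ y, F ζ y ∂m) U := by
  intro ζ hζ
  obtain ⟨V, hV, g, hg, hgV⟩ := hb ζ hζ
  obtain ⟨r, hr, hball⟩ := Metric.mem_nhds_iff.1 (Filter.inter_mem (hU.mem_nhds hζ) hV)
  have hderiv : ∀ᵐ y ∂m, ∀ w ∈ Metric.ball ζ (r / 2),
      HasDerivAt (fun ζ => F ζ y) (deriv (fun ζ => F ζ y) w) w ∧
        ‖deriv (fun ζ => F ζ y) w‖ ≤ g y / (r / 4) := by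
    filter_upwards [hd, hgV] with y hy hgy w hw
    have hsub : Metric.closedBall w (r / 4) ⊆ U ∩ V :=
      (Metric.closedBall_subset_ball' (by linarith [Metric.mem_ball.1 hw])).trans hball
    have hwU := hU.mem_nhds (hsub (Metric.mem_closedBall_self (by positivity))).1
    refine ⟨(hy.differentiableAt hwU).hasDerivAt,
      Complex.norm_deriv_le_of_forall_mem_sphere_norm_le (by positivity) ?_ fun v hv =>
        hgy v (hsub (Metric.sphere_subset_closedBall hv)).2⟩
    exact (hy.mono (hsub.trans inter_subset_left)).diffContOnCl_ball subset_rfl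
  have hmeas : ∀ᶠ w in nhds ζ, AEStronglyMeasurable (F w) m :=
    Filter.eventually_of_mem (hU.mem_nhds hζ) hF
  have hself := Metric.mem_ball_self (x := ζ) (half_pos hr)
  exact (hasDerivAt_integral_of_dominated_loc_of_deriv_le (Metric.ball_mem_nhds ζ (half_pos hr))
    hmeas (hg.mono' (hF ζ hζ) (hgV.mono fun y h => h ζ (mem_of_mem_nhds hV)))
    (aestronglyMeasurable_deriv_of_hasDerivAt hmeas (hderiv.mono fun y h => (h ζ hself).1))
    (hderiv.mono fun y h w hw => (h w hw).2) (hg.div_const _)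
    (hderiv.mono fun y h w hw => (h w hw).1)).2.differentiableAt.differentiableWithinAt

end Holomorphic

theorem differentiable_dslope_exp : Differentiable ℂ (dslope Complex.exp 0) :=
  differentiableOn_univ.1 ((Complex.differentiableOn_dslope Filter.univ_mem).2
    Complex.differentiable_exp.differentiableOn)

theorem norm_dslope_exp_le (v : ℂ) : ‖dslope Complex.exp 0 v‖ ≤ Real.exp ‖v‖ := by
  rcases eq_or_ne v 0 with rfl | hv
  · simp [dslope_same]
  · have h := Complex.norm_exp_sub_sum_le_norm_mul_exp v 1
    rw [dslope_of_ne _ hv, slope_def_field, norm_div, div_le_iff₀ (by simpa using hv), mul_comm]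
    simpa using h

/-- The difference `1/(ζ-p) - e⁻ᴬ/⁴ᵀ/(ζ-p)` with `A = (ζ-z)² - (p-z)²`, extended to an entire
function of `ζ`: the contribution to the pole at `p` of the sources at `z` that act more than `T`
units of time before the observation. -/
def poleRemainder (T : ℝ) (z p ζ : ℂ) : ℂ :=
  ((ζ - z) + (p - z)) / (4 * T) * dslope Complex.exp 0 (-(((ζ - z) ^ 2 - (p - z) ^ 2) / (4 * T)))

section Poles

variable {T : ℝ} {z p ζ : ℂ}

theorem poleRemainder_eq (hT : T ≠ 0) (hA : (ζ - z) ^ 2 - (p - z) ^ 2 ≠ 0) :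
    poleRemainder T z p ζ = 1 / (ζ - p) - ((ζ - z) + (p - z)) / ((ζ - z) ^ 2 - (p - z) ^ 2) *
      Complex.exp (-(((ζ - z) ^ 2 - (p - z) ^ 2) / (4 * T))) := by
  have hT' : (T : ℂ) ≠ 0 := Complex.ofReal_ne_zero.2 hT
  have hfactor : (ζ - z) ^ 2 - (p - z) ^ 2 = (ζ - p) * ((ζ - z) + (p - z)) := by ring
  have hpole : 1 / (ζ - p) = ((ζ - z) + (p - z)) / ((ζ - z) ^ 2 - (p - z) ^ 2) := by
    rw [hfactor] at hA ⊢
    field_simp [left_ne_zero_of_mul hA, right_ne_zero_of_mul hA]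
  rw [poleRemainder, hpole]
  generalize (ζ - z) ^ 2 - (p - z) ^ 2 = A at hA
  rw [dslope_of_ne _ (neg_ne_zero.2 (div_ne_zero hA (by simpa using hT))), slope_def_field,
    Complex.exp_zero, sub_zero]
  field_simp
  ring

theorem differentiable_poleRemainder (T : ℝ) (z p : ℂ) :
    Differentiable ℂ (poleRemainder T z p) :=
  (by fun_prop : Differentiable ℂ fun ζ : ℂ => ((ζ - z) + (p - z)) / (4 * T)).mul
    (differentiable_dslope_exp.comp (by fun_prop))

theorem continuous_poleRemainder_pole (T : ℝ) (z ζ : ℂ) :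
    Continuous fun p => poleRemainder T z p ζ :=
  (by fun_prop : Continuous fun p : ℂ => ((ζ - z) + (p - z)) / (4 * T)).mul
    (differentiable_dslope_exp.continuous.comp (by fun_prop))

theorem norm_poleRemainder_le (hT : 0 < T) {Z : ℝ} (hp : ‖p‖ ≤ Z) :
    ‖poleRemainder T z p ζ‖ ≤ 1 / (4 * T) * Real.exp ((1 + 1 / (4 * T)) * (2 * (Z + 2 * ‖z‖) ^ 2)) *
      Real.exp ((1 + 1 / (4 * T)) * 2 * ‖ζ‖ ^ 2) := by
  set s := ‖ζ‖ + (Z + 2 * ‖z‖)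
  have hnorm4T : ‖(4 * T : ℂ)‖ = 4 * T := by
    rw [norm_mul, Complex.norm_ofNat, Complex.norm_of_nonneg hT.le]
  have hsum : ‖(ζ - z) + (p - z)‖ ≤ s :=
    (norm_add_le _ _).trans (by linarith [norm_sub_le ζ z, norm_sub_le p z])
  have hsnonneg : 0 ≤ s := (norm_nonneg _).trans hsum
  have hprod : ‖(ζ - z) ^ 2 - (p - z) ^ 2‖ ≤ s * s := by
    rw [show (ζ - z) ^ 2 - (p - z) ^ 2 = (ζ - p) * ((ζ - z) + (p - z)) by ring, norm_mul]
    gcongr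
    linarith [norm_sub_le ζ p, norm_nonneg z]
  have hs2 : s ^ 2 ≤ 2 * (Z + 2 * ‖z‖) ^ 2 + 2 * ‖ζ‖ ^ 2 := by
    nlinarith [sq_nonneg (‖ζ‖ - (Z + 2 * ‖z‖))]
  calc ‖poleRemainder T z p ζ‖
      ≤ s / (4 * T) * Real.exp (s * s / (4 * T)) := by
        rw [poleRemainder, norm_mul, norm_div, hnorm4T]
        refine mul_le_mul (by gcongr) ((norm_dslope_exp_le _).trans ?_) (norm_nonneg _)
          (by positivity)
        rw [norm_neg, norm_div, hnorm4T]
        gcongr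
    _ ≤ Real.exp (s ^ 2) / (4 * T) * Real.exp (s * s / (4 * T)) := by
        gcongr
        nlinarith [Real.add_one_le_exp (s ^ 2), sq_nonneg (s - 1)]
    _ = 1 / (4 * T) * Real.exp ((1 + 1 / (4 * T)) * s ^ 2) := by
        rw [add_mul 1 (1 / (4 * T)), Real.exp_add, one_mul, one_div_mul_eq_div _ (s ^ 2), sq]
        ring
    _ ≤ 1 / (4 * T) * Real.exp ((1 + 1 / (4 * T)) * (2 * (Z + 2 * ‖z‖) ^ 2 + 2 * ‖ζ‖ ^ 2)) := by
        gcongr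
    _ = _ := by rw [mul_add, Real.exp_add, ← mul_assoc, mul_assoc _ 2 (‖ζ‖ ^ 2)]

variable {Y : Type*} [MeasurableSpace Y] {m : Measure Y} {β P : Y → ℂ} {L Z : ℝ}

theorem integrable_mul_poleRemainder (hT : 0 < T) (hP : AEStronglyMeasurable P m)
    (hPZ : ∀ᵐ y ∂m, ‖P y‖ ≤ Z) (hβ : Integrable β m) (z ζ : ℂ) :
    Integrable (fun y => β y * poleRemainder T z (P y) ζ) m :=
  hβ.mul_bdd ((continuous_poleRemainder_pole T z ζ).comp_aestronglyMeasurable hP)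
    (hPZ.mono fun _ hy => norm_poleRemainder_le hT hy)

theorem classicallyReachable_integral_poleRemainder (hL : 0 < L) (hT : 0 < T)
    (hP : AEStronglyMeasurable P m) (hPZ : ∀ᵐ y ∂m, ‖P y‖ ≤ Z) (hβ : Integrable β m) (z : ℂ) :
    ClassicallyReachable L T fun x => ∫ y, β y * poleRemainder T z (P y) x ∂m := by
  set M := 1 / (4 * T) * Real.exp ((1 + 1 / (4 * T)) * (2 * (Z + 2 * ‖z‖) ^ 2))
  set B := (1 + 1 / (4 * T)) * 2
  have hbound : ∀ᵐ y ∂m, ∀ ζ, ‖β y * poleRemainder T z (P y) ζ‖ ≤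
      M * Real.exp (B * ‖ζ‖ ^ 2) * ‖β y‖ := by
    filter_upwards [hPZ] with y hy ζ
    rw [norm_mul, mul_comm]
    gcongr
    exact norm_poleRemainder_le hT hy
  refine classicallyReachable_of_entire (B := B) (C := M * ∫ y, ‖β y‖ ∂m) hL hT
    (r := fun ζ => ∫ y, β y * poleRemainder T z (P y) ζ ∂m) ?_ fun ζ => ?_
  · refine differentiableOn_univ.1 (differentiableOn_integral_of_isOpen isOpen_univ
      (fun ζ _ => (integrable_mul_poleRemainder hT hP hPZ hβ z ζ).aestronglyMeasurable)
      (.of_forall fun y => ((differentiable_poleRemainder T z _).const_mul _).differentiableOn)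
      fun ζ _ => ⟨Metric.ball ζ 1, Metric.ball_mem_nhds ζ one_pos, _,
        hβ.norm.const_mul (M * Real.exp (B * (‖ζ‖ + 1) ^ 2)), ?_⟩)
    filter_upwards [hbound] with y hy w hw
    refine (hy w).trans ?_
    have hw' : ‖w‖ ≤ ‖ζ‖ + 1 := by
      linarith [norm_le_norm_add_norm_sub' w ζ, mem_ball_iff_norm.1 hw]
    gcongr
  · refine (norm_integral_le_of_norm_le (hβ.norm.const_mul _)
      (hbound.mono fun y hy => hy ζ)).trans_eq ?_
    rw [integral_const_mul]
    ring

/- With `A = (x-z)² - (p-z)²` one has `1/(x-p) = (x-z)/A + (p-z)/A`: the pole is the sum of what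
dipoles and monopoles at `z` emit. -/
theorem classicallyReachable_integral_div_sub [SFinite m] {z : ℝ} (hL : 0 < L) (hT : 0 < T)
    (hz : L < |z|) (hP : AEStronglyMeasurable P m) (hPZ : ∀ᵐ y ∂m, ‖P y‖ ≤ Z)
    (hPz : ∀ᵐ y ∂m, ((P y - z) ^ 2).re ≤ 0) (hβ : Integrable β m) :
    ClassicallyReachable L T fun x => ∫ y, β y / (x - P y) ∂m := by
  have hc : AEStronglyMeasurable (fun y => -(P y - z) ^ 2) m := by fun_prop
  have hre : ∀ᵐ y ∂m, 0 ≤ (-(P y - z) ^ 2).re := hPz.mono fun y hy => by simpa using hy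
  have hβP : Integrable (fun y => β y / 4 * (P y - z)) m :=
    (hβ.div_const 4).mul_bdd (c := Z + ‖(z : ℂ)‖) (by fun_prop)
      (hPZ.mono fun y hy => (norm_sub_le _ _).trans (by gcongr))
  have hmonopole := IsCausalKernel.monopole.classicallyReachable_truncated (a := 3 / 2)
    (w := fun _ => 1) (fun _ _ => (one_mul _).symm) (by norm_num) (by norm_num) hT hz hβP hc hre
  have hdipole := IsCausalKernel.dipole.classicallyReachable_truncated (a := 1 / 2)
    (w := fun x => x) (fun _ _ => rfl) (by norm_num) (by norm_num) hT hz (hβ.div_const 4) hc hre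
  refine ((hmonopole.add hdipole).add
    (classicallyReachable_integral_poleRemainder hL hT hP hPZ hβ z)).congr fun x hx => ?_
  have hX : x - z ≠ 0 := by
    rintro h
    exact ((abs_lt.2 hx).trans hz).ne (by rw [sub_eq_zero.1 h])
  have hgauss := fun {β'} (hβ' : Integrable β' m) (w : ℝ) =>
    integrable_mul_four_div_mul_exp hβ' hc hre hT.le hX w
  rw [Pi.add_apply, Pi.add_apply, ← integral_add' (hgauss hβP 1) (hgauss (hβ.div_const 4) (x - z)),
    ← integral_add' ((hgauss hβP 1).add (hgauss (hβ.div_const 4) (x - z)))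
      (integrable_mul_poleRemainder hT hP hPZ hβ z x)]
  refine integral_congr_ae (hre.mono fun y hy => ?_)
  have hA : ((x : ℂ) - z) ^ 2 - (P y - z) ^ 2 ≠ 0 := fun h => by
    have hsq : 0 < (((x - z : ℝ) : ℂ) ^ 2 + -(P y - z) ^ 2).re := by
      rw [Complex.add_re, ← Complex.ofReal_pow, Complex.ofReal_re]
      positivity
    rw [Complex.ofReal_sub, ← sub_eq_add_neg, h] at hsq
    exact hsq.false
  simp only [Pi.add_apply, poleRemainder_eq hT.ne' hA, Complex.ofReal_sub, Complex.ofReal_one,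
    ← sub_eq_add_neg]
  ring

end Poles

/-- The `k`-th side of the square `[-r, r] × [-r, r]`, counted anticlockwise from the right one. -/
def squareSide (r : ℝ) (k : ℕ) (y : ℝ) : ℂ :=
  Complex.I ^ k * (r + y * Complex.I)

section Square

variable {r : ℝ} {f : ℂ → ℂ} {c : ℂ}

theorem continuous_squareSide (r : ℝ) (k : ℕ) : Continuous (squareSide r k) := by
  unfold squareSide
  fun_prop

theorem squareSide_mem (k : ℕ) {y : ℝ} (hy : y ∈ uIcc (-r) r) :
    squareSide r k y ∈ uIcc (-r) r ×ℂ uIcc (-r) r := by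
  have : -y ∈ uIcc (-r) r := by
    simpa only [mem_uIcc, neg_le_neg_iff, neg_le, le_neg, and_comm, or_comm] using hy
  induction k with
  | zero => simpa [squareSide, Complex.mem_reProdIm] using hy
  | succ k ih =>
    rw [squareSide, pow_succ', mul_assoc, ← squareSide, Complex.mem_reProdIm]
    simpa [mem_uIcc, neg_le, le_neg, and_comm] using ih.symm

theorem sum_integral_squareSide_eq_zero (hf : DifferentiableOn ℂ f (uIcc (-r) r ×ℂ uIcc (-r) r)) :
    ∑ k ∈ Finset.range 4, Complex.I ^ (k + 1) * ∫ y in -r..r, f (squareSide r k y) = 0 := by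
  have hrect : (∫ x in -r..r, f (x + -r * Complex.I)) - (∫ x in -r..r, f (x + r * Complex.I)) +
      Complex.I * (∫ y in -r..r, f (r + y * Complex.I)) -
      Complex.I * (∫ y in -r..r, f (-r + y * Complex.I)) = 0 := by
    simpa using Complex.integral_boundary_rect_eq_zero_of_differentiableOn f
      (-r - r * Complex.I) (r + r * Complex.I) (by simpa using hf)
  have htop : ∫ y in -r..r, f (squareSide r 1 y) = ∫ x in -r..r, f (x + r * Complex.I) := by
    have := intervalIntegral.integral_comp_neg (a := -r) (b := r)
      fun x : ℝ => f (x + r * Complex.I)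
    rw [neg_neg] at this
    rw [← this]
    congr! 3 with y
    simp only [squareSide, pow_one, Complex.ofReal_neg]
    linear_combination (y : ℂ) * Complex.I_sq
  have hleft : ∫ y in -r..r, f (squareSide r 2 y) = ∫ y in -r..r, f (-r + y * Complex.I) := by
    have := intervalIntegral.integral_comp_neg (a := -r) (b := r)
      fun y : ℝ => f (-r + y * Complex.I)
    rw [neg_neg] at this
    rw [← this]
    congr! 3 with y
    simp only [squareSide, Complex.I_sq, Complex.ofReal_neg]
    ring
  have hbottom (y : ℝ) : squareSide r 3 y = y + -r * Complex.I := by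
    simp only [squareSide, Complex.I_pow_three]
    linear_combination -(y : ℂ) * Complex.I_sq
  have hright (y : ℝ) : squareSide r 0 y = r + y * Complex.I := by simp [squareSide]
  simp only [Finset.sum_range_succ, Finset.sum_range_zero, htop, hleft, hbottom, hright, zero_add,
    pow_one, Nat.reduceAdd, Complex.I_sq, Complex.I_pow_three, Complex.I_pow_four]
  linear_combination hrect

theorem integral_inv_sub_right_side (hc : c.re < r) :
    ∫ y in -r..r, Complex.I * (r + y * Complex.I - c)⁻¹ =
      Complex.log (r + r * Complex.I - c) - Complex.log (r - r * Complex.I - c) := by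
  have hslit : ∀ y : ℝ, (r + y * Complex.I - c : ℂ) ∈ Complex.slitPlane := fun y =>
    .inl (by simpa using hc)
  have hderiv : ∀ y : ℝ, HasDerivAt (fun y : ℝ => Complex.log (r + y * Complex.I - c))
      (Complex.I * (r + y * Complex.I - c)⁻¹) y := fun y => by
    have := ((((hasDerivAt_id y).ofReal_comp.mul_const Complex.I).const_add (r : ℂ)).sub_const
      c).clog_real (hslit y)
    simpa [div_eq_mul_inv] using this
  rw [intervalIntegral.integral_eq_sub_of_hasDerivAt (fun y _ => hderiv y)
    (Continuous.intervalIntegrable (continuous_const.mul (Continuous.inv₀ (by fun_prop) fun y =>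
      Complex.slitPlane_ne_zero (hslit y))) _ _)]
  simp [sub_eq_add_neg]

theorem log_neg_I_mul {a : ℂ} (ha : a ≠ 0) (him : 0 ≤ a.im) :
    Complex.log (-Complex.I * a) = Complex.log a - Real.pi / 2 * Complex.I := by
  have harg : 0 ≤ a.arg := Complex.arg_nonneg_iff.2 him
  rw [Complex.log_mul (by simp) ha, Complex.log_neg_I]
  · ring
  · rw [Complex.arg_neg_I]
    constructor <;> linarith [Complex.arg_le_pi a, Real.pi_pos]

theorem neg_I_pow_mul_mem (hc : c ∈ Ioo (-r) r ×ℂ Ioo (-r) r) (k : ℕ) :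
    (-Complex.I) ^ k * c ∈ Ioo (-r) r ×ℂ Ioo (-r) r := by
  induction k with
  | zero => simpa using hc
  | succ k ih =>
    rw [pow_succ', mul_assoc]
    generalize (-Complex.I) ^ k * c = a at ih
    simpa [Complex.mem_reProdIm, neg_lt, and_comm] using ih

theorem squareSide_sub_eq (r : ℝ) (k : ℕ) (y : ℝ) (c : ℂ) :
    squareSide r k y - c = Complex.I ^ k * (r + y * Complex.I - (-Complex.I) ^ k * c) := by
  rw [mul_sub, ← squareSide, ← mul_assoc, ← mul_pow]
  simp

theorem squareSide_sub_ne_zero (hc : c ∈ Ioo (-r) r ×ℂ Ioo (-r) r) (k : ℕ) (y : ℝ) :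
    squareSide r k y - c ≠ 0 := by
  rw [squareSide_sub_eq]
  refine mul_ne_zero (pow_ne_zero _ Complex.I_ne_zero) fun h => ?_
  have hre := congrArg Complex.re h
  have hlt := (neg_I_pow_mul_mem hc k).1.2
  generalize (-Complex.I) ^ k * c = a at hre hlt
  simp only [Complex.sub_re, Complex.add_re, Complex.ofReal_re, Complex.re_ofReal_mul,
    Complex.I_re, mul_zero, add_zero, Complex.zero_re] at hre
  exact (sub_pos.2 hlt).ne' hre

/- Turning the `k`-th side onto the right one turns `c` into `(-I) ^ k * c`, and a quarter turn
takes the end of each side to the beginning of the next: every corner contributes `π / 2`. -/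
theorem sum_integral_inv_squareSide_sub (hc : c ∈ Ioo (-r) r ×ℂ Ioo (-r) r) :
    ∑ k ∈ Finset.range 4, Complex.I ^ (k + 1) * ∫ y in -r..r, (squareSide r k y - c)⁻¹ =
      2 * Real.pi * Complex.I := by
  set start : ℕ → ℂ := fun k => r - r * Complex.I - (-Complex.I) ^ k * c with hstart
  set finish : ℕ → ℂ := fun k => r + r * Complex.I - (-Complex.I) ^ k * c with hfinish
  have hside : ∀ k, Complex.I ^ (k + 1) * ∫ y in -r..r, (squareSide r k y - c)⁻¹ =
      Complex.log (finish k) - Complex.log (start k) := fun k => by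
    rw [← integral_inv_sub_right_side (neg_I_pow_mul_mem hc k).1.2,
      ← intervalIntegral.integral_const_mul]
    refine intervalIntegral.integral_congr fun y _ => ?_
    simp only [squareSide_sub_eq r k y c]
    field_simp
    ring
  have hcorner : ∀ k, Complex.log (start (k + 1)) =
      Complex.log (finish k) - Real.pi / 2 * Complex.I := fun k => by
    obtain ⟨hre, him⟩ := neg_I_pow_mul_mem hc k
    have hre' : 0 < (finish k).re := by simpa [hfinish] using hre.2
    have him' : 0 < (finish k).im := by simpa [hfinish] using him.2
    rw [← log_neg_I_mul (by rintro h; simp [h] at hre') him'.le]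
    simp only [hstart, hfinish, pow_succ]
    congr 1
    linear_combination (r : ℂ) * Complex.I_sq
  have hclosed : start 4 = start 0 := by simp [hstart, Even.neg_pow (by decide : Even 4)]
  simp only [hside, Finset.sum_range_succ, Finset.sum_range_zero]
  linear_combination -hcorner 0 - hcorner 1 - hcorner 2 - hcorner 3 + congrArg Complex.log hclosed

theorem sum_integral_squareSide_div_sub (hf : DifferentiableOn ℂ f (uIcc (-r) r ×ℂ uIcc (-r) r))
    (hc : c ∈ Ioo (-r) r ×ℂ Ioo (-r) r) :
    ∑ k ∈ Finset.range 4, Complex.I ^ (k + 1) *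
      ∫ y in -r..r, f (squareSide r k y) / (squareSide r k y - c) =
      2 * Real.pi * Complex.I * f c := by
  have hnhds : uIcc (-r) r ×ℂ uIcc (-r) r ∈ nhds c := by
    rw [uIcc_of_le (by linarith [hc.1.1.trans hc.1.2])]
    exact Filter.mem_of_superset ((isOpen_Ioo.reProdIm isOpen_Ioo).mem_nhds hc)
      (inter_subset_inter (preimage_mono Ioo_subset_Icc_self) (preimage_mono Ioo_subset_Icc_self))
  have hg := (Complex.differentiableOn_dslope hnhds).2 hf
  have hne := squareSide_sub_ne_zero hc
  have hsplit (k : ℕ) : ∫ y in -r..r, f (squareSide r k y) / (squareSide r k y - c) =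
      (∫ y in -r..r, dslope f c (squareSide r k y)) +
        f c * ∫ y in -r..r, (squareSide r k y - c)⁻¹ := by
    have hslope : IntervalIntegrable (fun y => dslope f c (squareSide r k y)) volume (-r) r :=
      (hg.continuousOn.comp (continuous_squareSide r k).continuousOn
        fun y => squareSide_mem k).intervalIntegrable
    have hinv : IntervalIntegrable (fun y => f c * (squareSide r k y - c)⁻¹) volume (-r) r :=
      (continuous_const.mul (((continuous_squareSide r k).sub continuous_const).inv₀
        (hne k))).intervalIntegrable _ _
    rw [← intervalIntegral.integral_const_mul, ← intervalIntegral.integral_add hslope hinv]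
    refine intervalIntegral.integral_congr fun y _ => ?_
    simp only [dslope_of_ne f (sub_ne_zero.1 (hne k y)), slope_def_field]
    field_simp [hne k y]
    ring
  simp only [hsplit, mul_add, Finset.sum_add_distrib, sum_integral_squareSide_eq_zero hg, zero_add,
    mul_left_comm _ (f c), ← Finset.mul_sum, sum_integral_inv_squareSide_sub hc]
  ring

end Square

theorem mem_diamond {r : ℝ} {w : ℂ} (hw : w ∈ uIcc (-r) r ×ℂ uIcc (-r) r) (hr : 0 ≤ r) :
    |((1 + Complex.I) * w).re| + |((1 + Complex.I) * w).im| ≤ 2 * r := by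
  rw [Complex.mem_reProdIm, uIcc_of_le (neg_le_self hr)] at hw
  obtain ⟨⟨hre, hre'⟩, him, him'⟩ := hw
  have hre_mul : ((1 + Complex.I) * w).re = w.re - w.im := by simp
  have him_mul : ((1 + Complex.I) * w).im = w.im + w.re := by simp
  rw [hre_mul, him_mul]
  cases abs_cases (w.re - w.im) <;> cases abs_cases (w.im + w.re) <;> linarith

theorem exists_mem_square_mul_eq {r x : ℝ} (hx : |x| < 2 * r) :
    ∃ c ∈ Ioo (-r) r ×ℂ Ioo (-r) r, (1 + Complex.I) * c = x := by
  rw [abs_lt] at hx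
  refine ⟨(1 - Complex.I) / 2 * x, ?_, by linear_combination -(x : ℂ) / 2 * Complex.I_sq⟩
  have hre : ((1 - Complex.I) / 2 * x).re = x / 2 := by
    simp only [Complex.re_mul_ofReal, Complex.div_ofNat_re, Complex.sub_re, Complex.one_re,
      Complex.I_re]
    ring
  have him : ((1 - Complex.I) / 2 * x).im = -(x / 2) := by
    simp only [Complex.im_mul_ofReal, Complex.div_ofNat_im, Complex.sub_im, Complex.one_im,
      Complex.I_im]
    ring
  rw [Complex.mem_reProdIm, hre, him]
  constructor <;> constructor <;> linarith

theorem exists_re_sq_squareSide_sub_eq_zero (r : ℝ) {k : ℕ} (hk : k < 4) :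
    ∃ z : ℝ, |z| = 2 * |r| ∧ ∀ y : ℝ, (((1 + Complex.I) * squareSide r k y - z) ^ 2).re = 0 := by
  refine ⟨if k = 0 ∨ k = 3 then 2 * r else -(2 * r), ?_, fun y => ?_⟩
  · split_ifs <;> simp [abs_mul]
  · interval_cases k <;> simp [squareSide, sq, Complex.I_pow_three] <;> ring

/- Seen from the vertex `±2r` of the diamond at which it ends, each side has slope `±1`. -/
theorem classicallyReachable_integral_div_sub_squareSide {L T r : ℝ} {φ : ℝ → ℂ} {k : ℕ}
    (hL : 0 < L) (hT : 0 < T) (hLr : L < 2 * r) (hk : k < 4)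
    (hφ : IntervalIntegrable φ volume (-r) r) :
    ClassicallyReachable L T fun x =>
      ∫ y in -r..r, φ y / (x - (1 + Complex.I) * squareSide r k y) := by
  have hr : 0 < r := by linarith
  obtain ⟨z, hz, hsq⟩ := exists_re_sq_squareSide_sub_eq_zero r hk
  have hcont : Continuous fun y => (1 + Complex.I) * squareSide r k y :=
    continuous_const.mul (continuous_squareSide r k)
  obtain ⟨Z, hZ⟩ := isCompact_Icc.exists_bound_of_continuousOn (s := Icc (-r) r) hcont.continuousOn
  simp only [intervalIntegral.integral_of_le (neg_le_self hr.le)]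
  refine classicallyReachable_integral_div_sub (z := z) (Z := Z) hL hT
    (by rwa [hz, abs_of_pos hr]) hcont.aestronglyMeasurable ?_ (.of_forall fun y => (hsq y).le) hφ.1
  filter_upwards [ae_restrict_mem measurableSet_Ioc] with y hy
  exact hZ y (Ioc_subset_Icc_self hy)

/- Cauchy's formula on the boundary of a slightly smaller diamond writes `f x` as a superposition
of poles. -/
theorem classicallyReachable_of_differentiableOn_diamond {L R T : ℝ} {f : ℂ → ℂ} (hL : 0 < L)
    (hLR : L < R) (hT : 0 < T) (hf : DifferentiableOn ℂ f {ζ | |ζ.re| + |ζ.im| < R}) :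
    ClassicallyReachable L T fun x => f x := by
  obtain ⟨r, hLr, hrR⟩ : ∃ r, L / 2 < r ∧ r < R / 2 := exists_between (by linarith)
  have hr : 0 < r := by linarith
  set g : ℂ → ℂ := fun w => f ((1 + Complex.I) * w)
  have hg : DifferentiableOn ℂ g (uIcc (-r) r ×ℂ uIcc (-r) r) :=
    hf.comp (by fun_prop) fun w hw => (mem_diamond hw hr.le).trans_lt (by linarith)
  set q : ℕ → ℂ := fun k =>
    -((2 * Real.pi * Complex.I)⁻¹ * Complex.I ^ (k + 1) * (1 + Complex.I)) with hq
  have hside : ∀ k ∈ Finset.range 4, ClassicallyReachable L T fun x =>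
      ∫ y in -r..r, q k * g (squareSide r k y) / (x - (1 + Complex.I) * squareSide r k y) :=
    fun k hk => classicallyReachable_integral_div_sub_squareSide hL hT (by linarith)
      (Finset.mem_range.1 hk) (ContinuousOn.intervalIntegrable (continuousOn_const.mul
        (hg.continuousOn.comp (continuous_squareSide r k).continuousOn fun y => squareSide_mem k)))
  refine (ClassicallyReachable.sum hside).congr fun x hx => ?_
  obtain ⟨c, hc, hxc⟩ := exists_mem_square_mul_eq (r := r) (x := x)
    (abs_lt.2 ⟨by linarith [hx.1], by linarith [hx.2]⟩)
  have hterm (k : ℕ) : ∫ y in -r..r,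
      q k * g (squareSide r k y) / (x - (1 + Complex.I) * squareSide r k y) =
      (2 * Real.pi * Complex.I)⁻¹ * (Complex.I ^ (k + 1) * ∫ y in -r..r,
        g (squareSide r k y) / (squareSide r k y - c)) := by
    simp only [← intervalIntegral.integral_const_mul]
    refine intervalIntegral.integral_congr fun y _ => ?_
    have hI : (1 + Complex.I) ≠ 0 := fun h => by simpa using congrArg Complex.re h
    simp only [hq]
    rw [← hxc, ← mul_sub, ← neg_sub (squareSide r k y) c]
    field_simp [squareSide_sub_ne_zero hc k y]
  simp only [hterm, ← Finset.mul_sum, sum_integral_squareSide_div_sub hg hc]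
  rw [← congrArg f hxc]
  exact inv_mul_cancel_left₀ Complex.two_pi_I_ne_zero (g c)

/-- The function `D(ζ, y) = (ζ - y)² + L₀² - y² - iα(y)`, with complex `ζ`: up to a power of `t`,
the product of the heat kernel and the source is `exp (-D(x, y) / 4t) h(y)`. -/
def sourceDenom (L₀ : ℝ) (α : ℝ → ℝ) (ζ : ℂ) (y : ℝ) : ℂ :=
  (ζ - y) ^ 2 + L₀ ^ 2 - y ^ 2 - Complex.I * α y

/-- The analytic continuation of `w₀` to the diamond `|Re ζ| + |Im ζ| < L₀`. -/
def stateExtension (L₀ : ℝ) (α : ℝ → ℝ) (h : ℝ → ℂ) (ζ : ℂ) : ℂ :=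
  ((2 / Real.sqrt Real.pi : ℝ) : ℂ) * ∫ y in Ioo (-L₀) L₀, h y / sourceDenom L₀ α ζ y

section State

variable {L₀ x y t : ℝ} {α : ℝ → ℝ} {h : ℝ → ℂ} {ζ : ℂ}

theorem sq_le_re_sourceDenom (hζ : |ζ.re| + |ζ.im| ≤ L₀) (hy : y ∈ Ioo (-L₀) L₀) :
    (L₀ - (|ζ.re| + |ζ.im|)) ^ 2 ≤ (sourceDenom L₀ α ζ y).re := by
  have hre : (sourceDenom L₀ α ζ y).re = |ζ.re| ^ 2 - |ζ.im| ^ 2 - 2 * (ζ.re * y) + L₀ ^ 2 := by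
    simp only [sourceDenom, sq, Complex.sub_re, Complex.add_re, Complex.mul_re, Complex.ofReal_re,
      Complex.sub_im, Complex.ofReal_im, Complex.I_re, Complex.I_im, abs_mul_abs_self]
    ring
  have hprod : ζ.re * y ≤ |ζ.re| * L₀ := (le_abs_self _).trans (by
    rw [abs_mul]
    gcongr
    exact (abs_lt.2 hy).le)
  rw [hre]
  nlinarith [mul_nonneg (abs_nonneg ζ.im) (sub_nonneg.2 hζ)]

theorem re_sourceDenom_pos (hζ : |ζ.re| + |ζ.im| < L₀) (hy : y ∈ Ioo (-L₀) L₀) :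
    0 < (sourceDenom L₀ α ζ y).re :=
  (pow_pos (sub_pos.2 hζ) 2).trans_le (sq_le_re_sourceDenom hζ.le hy)

theorem aemeasurable_sourceDenom {μ : Measure ℝ} (hα : AEMeasurable α μ) (L₀ : ℝ) (ζ : ℂ) :
    AEMeasurable (sourceDenom L₀ α ζ) μ := by
  unfold sourceDenom
  fun_prop

theorem norm_div_sourceDenom_le {s : ℝ} (hζ : |ζ.re| + |ζ.im| ≤ s) (hs : s < L₀)
    (hy : y ∈ Ioo (-L₀) L₀) : ‖h y / sourceDenom L₀ α ζ y‖ ≤ ‖h y‖ / (L₀ - s) ^ 2 := by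
  have : 0 < L₀ - s := sub_pos.2 hs
  rw [norm_div]
  gcongr
  calc (L₀ - s) ^ 2 ≤ (L₀ - (|ζ.re| + |ζ.im|)) ^ 2 := by gcongr
    _ ≤ (sourceDenom L₀ α ζ y).re := sq_le_re_sourceDenom (hζ.trans hs.le) hy
    _ ≤ ‖sourceDenom L₀ α ζ y‖ := Complex.re_le_norm _

theorem integrableOn_div_sourceDenom (hα : AEMeasurable α (volume.restrict (Ioo (-L₀) L₀)))
    (hh : IntegrableOn h (Ioo (-L₀) L₀)) (hζ : |ζ.re| + |ζ.im| < L₀) :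
    IntegrableOn (fun y => h y / sourceDenom L₀ α ζ y) (Ioo (-L₀) L₀) := by
  refine (hh.norm.div_const ((L₀ - (|ζ.re| + |ζ.im|)) ^ 2)).mono'
    (hh.aemeasurable.div (aemeasurable_sourceDenom hα L₀ ζ)).aestronglyMeasurable ?_
  filter_upwards [ae_restrict_mem measurableSet_Ioo] with y hy
  exact norm_div_sourceDenom_le le_rfl hζ hy

theorem differentiableOn_stateExtension (hα : AEMeasurable α (volume.restrict (Ioo (-L₀) L₀)))
    (hh : IntegrableOn h (Ioo (-L₀) L₀)) :
    DifferentiableOn ℂ (stateExtension L₀ α h) {ζ | |ζ.re| + |ζ.im| < L₀} := by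
  have hopen (s : ℝ) : IsOpen {ζ : ℂ | |ζ.re| + |ζ.im| < s} :=
    isOpen_lt (by fun_prop) continuous_const
  refine (differentiableOn_integral_of_isOpen (hopen L₀)
    (fun ζ hζ => (integrableOn_div_sourceDenom hα hh hζ).aestronglyMeasurable) ?_
    fun ζ hζ => ?_).const_mul _
  · filter_upwards [ae_restrict_mem measurableSet_Ioo] with y hy
    refine DifferentiableOn.div (by fun_prop) (by unfold sourceDenom; fun_prop) fun ζ hζ h0 => ?_
    simpa [h0] using re_sourceDenom_pos (α := α) hζ hy
  · obtain ⟨s, hζs, hs⟩ := exists_between (show |ζ.re| + |ζ.im| < L₀ from hζ)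
    refine ⟨_, (hopen s).mem_nhds hζs, _, hh.norm.div_const ((L₀ - s) ^ 2), ?_⟩
    filter_upwards [ae_restrict_mem measurableSet_Ioo] with y hy w hw
    exact norm_div_sourceDenom_le (le_of_lt hw) hs hy

theorem heatKernel_mul_source (L₀ : ℝ) (α : ℝ → ℝ) (h : ℝ → ℂ) (x y : ℝ) (ht : 0 < t) :
    (heatKernel t (x - y) : ℂ) * source L₀ α h t y =
      ((1 / Real.sqrt (4 * Real.pi) : ℝ) : ℂ) *
        (((t : ℂ) ^ 2)⁻¹ * Complex.exp (-(sourceDenom L₀ α x y / (4 * t))) * h y) := by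
  have hpow : Real.sqrt (4 * Real.pi * t) * t ^ (3 / 2 : ℝ) = Real.sqrt (4 * Real.pi) * t ^ 2 := by
    rw [Real.sqrt_mul (by positivity), Real.sqrt_eq_rpow t, mul_assoc, ← Real.rpow_add ht]
    norm_num
  have hconst : ((1 / Real.sqrt (4 * Real.pi * t) : ℝ) : ℂ) * (1 / (t ^ (3 / 2 : ℝ) : ℝ)) =
      (1 / Real.sqrt (4 * Real.pi) : ℝ) * ((t : ℂ) ^ 2)⁻¹ := by
    rw [Complex.ofReal_div, Complex.ofReal_one, one_div_mul_one_div, ← Complex.ofReal_mul, hpow]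
    push_cast
    rw [one_div, one_div, mul_inv]
  have hexp : Complex.exp (-(sourceDenom L₀ α x y / (4 * t))) =
      Complex.exp ((-(x - y) ^ 2 / (4 * t) : ℝ) : ℂ) *
      Complex.exp (((y ^ 2 - L₀ ^ 2) / (4 * t) : ℝ) + Complex.I * ((α y / (4 * t) : ℝ) : ℂ)) := by
    rw [← Complex.exp_add, sourceDenom]
    push_cast
    ring_nf
  rw [hexp, heatKernel, source, Complex.ofReal_mul, Complex.ofReal_exp]
  linear_combination (Complex.exp ((-(x - y) ^ 2 / (4 * t) : ℝ) : ℂ) *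
    Complex.exp (((y ^ 2 - L₀ ^ 2) / (4 * t) : ℝ) + Complex.I * ((α y / (4 * t) : ℝ) : ℂ)) *
    h y) * hconst

theorem integrableOn_heatKernel_mul_source
    (hα : AEMeasurable α (volume.restrict (Ioo (-L₀) L₀))) (hh : IntegrableOn h (Ioo (-L₀) L₀))
    (hx : x ∈ Ioo (-L₀) L₀) :
    IntegrableOn (fun p : ℝ × ℝ => (heatKernel p.1 (x - p.2) : ℂ) * source L₀ α h p.1 p.2)
      (Ioi (0 : ℝ) ×ˢ Ioo (-L₀) L₀) := by
  have hset : MeasurableSet (Ioi (0 : ℝ) ×ˢ Ioo (-L₀) L₀) :=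
    measurableSet_Ioi.prod measurableSet_Ioo
  set δ : ℝ := (L₀ - |x|) ^ 2
  have hx' : 0 < L₀ - |x| := sub_pos.2 (abs_lt.2 hx)
  have hdom := (integrableOn_inv_sq_mul_exp (A := δ)
    (by rw [Complex.ofReal_re]; positivity)).norm.mul_prod hh.norm
  rw [Measure.prod_restrict, ← Measure.volume_eq_prod] at hdom
  refine IntegrableOn.congr_fun (Integrable.const_mul (hdom.mono' ?_ ?_) _)
    (fun p hp => (heatKernel_mul_source L₀ α h x p.2 hp.1).symm) hset
  · rw [Measure.volume_eq_prod, ← Measure.prod_restrict]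
    have hD := (aemeasurable_sourceDenom hα L₀ x).comp_snd (μ := volume.restrict (Ioi (0 : ℝ)))
    exact (AEMeasurable.mul (by fun_prop) hh.aemeasurable.comp_snd).aestronglyMeasurable
  · filter_upwards [ae_restrict_mem hset] with p hp
    have hsplit : Complex.exp (-(sourceDenom L₀ α x p.2 / (4 * p.1))) =
        Complex.exp (-(δ / (4 * p.1))) *
          Complex.exp (-((sourceDenom L₀ α x p.2 - δ) / (4 * p.1))) := by
      rw [← Complex.exp_add]
      ring_nf
    have hδD : 0 ≤ (sourceDenom L₀ α x p.2 - δ).re := by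
      simpa using sq_le_re_sourceDenom (ζ := x) (α := α) (by simpa using (abs_lt.2 hx).le) hp.2
    rw [hsplit, ← mul_assoc, norm_mul, norm_mul _ (Complex.exp (-((_ - _) / _)))]
    gcongr
    exact mul_le_of_le_one_right (norm_nonneg _) (norm_exp_neg_div_le_one hδD (le_of_lt hp.1))

theorem w₀_eq_stateExtension
    (hα : AEMeasurable α (volume.restrict (Ioo (-L₀) L₀))) (hh : IntegrableOn h (Ioo (-L₀) L₀))
    (hx : x ∈ Ioo (-L₀) L₀) : w₀ L₀ α h x = stateExtension L₀ α h x := by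
  have hint := integrableOn_heatKernel_mul_source hα hh hx
  rw [IntegrableOn, Measure.volume_eq_prod, ← Measure.prod_restrict] at hint
  rw [w₀, Measure.volume_eq_prod, ← Measure.prod_restrict, integral_prod_symm _ hint,
    stateExtension, ← integral_const_mul]
  refine setIntegral_congr_fun measurableSet_Ioo fun y hy => ?_
  have hre : 0 < (sourceDenom L₀ α x y).re := re_sourceDenom_pos (by simpa using abs_lt.2 hx) hy
  have hconst : ((1 / Real.sqrt (4 * Real.pi) : ℝ) : ℂ) * 4 = (2 / Real.sqrt Real.pi : ℝ) := by
    rw [show (4 : ℝ) = 2 ^ 2 by norm_num, Real.sqrt_mul (by norm_num), Real.sqrt_sq (by norm_num)]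
    push_cast
    ring
  simp only
  rw [setIntegral_congr_fun measurableSet_Ioi
    (fun t ht => heatKernel_mul_source L₀ α h x y ht), integral_const_mul, integral_mul_const,
    integral_Ioi_inv_sq_mul_exp hre, ← hconst]
  ring

theorem kernelIntegrand_eq (L₀ : ℝ) (α : ℝ → ℝ) (h : ℝ → ℂ) (x y : ℝ) :
    kernelIntegrand L₀ α h x y = h y / sourceDenom L₀ (-α) x y := by
  simp [kernelIntegrand, sourceDenom]

theorem K_eq_stateExtension (L₀ : ℝ) (α : ℝ → ℝ) (h : ℝ → ℂ) (x : ℝ) :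
    K L₀ α h x = stateExtension L₀ (-α) h x := by
  simp only [K, stateExtension, kernelIntegrand_eq]

theorem memLp_stateExtension {L : ℝ} (hL₀ : L < L₀)
    (hα : AEMeasurable α (volume.restrict (Ioo (-L₀) L₀))) (hh : IntegrableOn h (Ioo (-L₀) L₀))
    (p : ENNReal) :
    MemLp (fun x : ℝ => stateExtension L₀ α h x) p (volume.restrict (Ioo (-L) L)) := by
  have hcont : ContinuousOn (fun x : ℝ => stateExtension L₀ α h x) (Icc (-L) L) :=
    (differentiableOn_stateExtension hα hh).continuousOn.comp
      Complex.continuous_ofReal.continuousOn fun x hx => by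
        simpa using (abs_le.2 hx).trans_lt hL₀
  exact (memLp_of_continuousOn_of_isCompact hcont isCompact_Icc p).mono_measure
    (Measure.restrict_mono_set _ Ioo_subset_Icc_self)

end State

end HeatReach

end

open HeatReach in
theorem theorem4_general {L L₀ : ℝ} (hL : 0 < L) (hL₀ : L < L₀) {α : ℝ → ℝ}
    (hα : AEMeasurable α (volume.restrict (Ioo (-L₀) L₀))) {h : ℝ → ℂ}
    (hh : IntegrableOn h (Ioo (-L₀) L₀)) :
    ((∀ x ∈ Ioo (-L) L, IntegrableOn
          (fun p : ℝ × ℝ => (heatKernel p.1 (x - p.2) : ℂ) * source L₀ α h p.1 p.2)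
          (Ioi (0 : ℝ) ×ˢ Ioo (-L₀) L₀)) ∧
      MemLp (w₀ L₀ α h) 2 (volume.restrict (Ioo (-L) L)) ∧
      (∀ T : ℝ, 0 < T → w₀ L₀ α h ∈ reachableSet L T) ∧
      (∀ x ∈ Ioo (-L) L,
        IntegrableOn
          (fun y : ℝ => h y /
            ((((x - y) ^ 2 + L₀ ^ 2 - y ^ 2 : ℝ) : ℂ) - Complex.I * (α y : ℂ)))
          (Ioo (-L₀) L₀) ∧
        w₀ L₀ α h x =
          ((2 / Real.sqrt Real.pi : ℝ) : ℂ) * ∫ y in Ioo (-L₀) L₀, h y /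
            ((((x - y) ^ 2 + L₀ ^ 2 - y ^ 2 : ℝ) : ℂ) - Complex.I * (α y : ℂ)))) ∧
    ((∀ x ∈ Ioo (-L) L, IntegrableOn (kernelIntegrand L₀ α h x) (Ioo (-L₀) L₀)) ∧
      MemLp (K L₀ α h) 2 (volume.restrict (Ioo (-L) L))) ∧
    ∀ T : ℝ, 0 < T → K L₀ α h ∈ reachableSet L T := by
  have hx₀ : ∀ x ∈ Ioo (-L) L, x ∈ Ioo (-L₀) L₀ := fun x hx =>
    ⟨by linarith [hx.1], by linarith [hx.2]⟩
  have hdiamond : ∀ x ∈ Ioo (-L) L, |(x : ℂ).re| + |(x : ℂ).im| < L₀ := fun x hx => by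
    simpa using abs_lt.2 (hx₀ x hx)
  have hw : ∀ x ∈ Ioo (-L) L, stateExtension L₀ α h x = w₀ L₀ α h x := fun x hx =>
    (w₀_eq_stateExtension hα hh (hx₀ x hx)).symm
  have hdenom (x y : ℝ) : (((x - y) ^ 2 + L₀ ^ 2 - y ^ 2 : ℝ) : ℂ) - Complex.I * (α y : ℂ) =
      sourceDenom L₀ α x y := by simp [sourceDenom]
  have hreach {α : ℝ → ℝ} (hα : AEMeasurable α (volume.restrict (Ioo (-L₀) L₀))) {T : ℝ}
      (hT : 0 < T) : ClassicallyReachable L T fun x => stateExtension L₀ α h x :=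
    classicallyReachable_of_differentiableOn_diamond hL hL₀ hT
      (differentiableOn_stateExtension hα hh)
  simp only [hdenom, funext (K_eq_stateExtension L₀ α h), funext₂ (kernelIntegrand_eq L₀ α h)]
  refine ⟨⟨fun x hx => integrableOn_heatKernel_mul_source hα hh (hx₀ x hx), ?_,
    fun T hT => ((hreach hα hT).congr hw).mem_reachableSet hL, fun x hx =>
      ⟨integrableOn_div_sourceDenom hα hh (hdiamond x hx), (hw x hx).symm⟩⟩,
    ⟨fun x hx => integrableOn_div_sourceDenom hα.neg hh (hdiamond x hx),
      memLp_stateExtension hL₀ hα.neg hh 2⟩, fun T hT => (hreach hα.neg hT).mem_reachableSet hL⟩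
  exact (memLp_congr_ae ((ae_restrict_mem measurableSet_Ioo).mono hw)).1
    (memLp_stateExtension hL₀ hα hh 2)

theorem theorem4 (L L₀ : ℝ) (hL : 0 < L) (hL₀ : L < L₀) (α : ℝ → ℝ)
    (hα : ContinuousOn α (Set.Icc (-L₀) L₀)) :
    (∀ h : ℝ → ℂ, MemLp h 2 (volume.restrict (Set.Ioo (-L₀) L₀)) →
      -- the double integral that defines `w₀` converges absolutely
      (∀ x ∈ Set.Ioo (-L) L,
        IntegrableOn
          (fun p : ℝ × ℝ =>
            (HeatReach.heatKernel p.1 (x - p.2) : ℂ) * HeatReach.source L₀ α h p.1 p.2)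
          (Set.Ioi (0 : ℝ) ×ˢ Set.Ioo (-L₀) L₀)) ∧
      -- `w₀` is square integrable and reachable in every time
      MemLp (HeatReach.w₀ L₀ α h) 2 (volume.restrict (Set.Ioo (-L) L)) ∧
      (∀ T : ℝ, 0 < T → HeatReach.w₀ L₀ α h ∈ HeatReach.reachableSet L T) ∧
      -- the formula for `w₀`
      (∀ x ∈ Set.Ioo (-L) L,
        IntegrableOn
          (fun y : ℝ => h y /
            ((((x - y) ^ 2 + L₀ ^ 2 - y ^ 2 : ℝ) : ℂ) - Complex.I * (α y : ℂ)))
          (Set.Ioo (-L₀) L₀) ∧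
        HeatReach.w₀ L₀ α h x =
          ((2 / Real.sqrt Real.pi : ℝ) : ℂ) * ∫ y in Set.Ioo (-L₀) L₀, h y /
            ((((x - y) ^ 2 + L₀ ^ 2 - y ^ 2 : ℝ) : ℂ) - Complex.I * (α y : ℂ)))) ∧
    -- the range of `K_α` consists of square integrable reachable states
    (∀ h : ℝ → ℂ, MemLp h 2 (volume.restrict (Set.Ioo (-L₀) L₀)) →
      (∀ x ∈ Set.Ioo (-L) L,
        IntegrableOn (HeatReach.kernelIntegrand L₀ α h x) (Set.Ioo (-L₀) L₀)) ∧
      MemLp (HeatReach.K L₀ α h) 2 (volume.restrict (Set.Ioo (-L) L))) ∧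
    (∀ T : ℝ, 0 < T → HeatReach.rangeK L₀ α ⊆ HeatReach.reachableSet L T) := by
  have hαm : AEMeasurable α (volume.restrict (Ioo (-L₀) L₀)) :=
    (hα.mono Ioo_subset_Icc_self).aemeasurable measurableSet_Ioo
  have main {h : ℝ → ℂ} (hh : MemLp h 2 (volume.restrict (Ioo (-L₀) L₀))) :=
    theorem4_general hL hL₀ hαm (hh.integrable one_le_two)
  refine ⟨fun h hh => (main hh).1, fun h hh => (main hh).2.1, ?_⟩
  rintro T hT _ ⟨h, hh, rfl⟩
  exact (main hh).2.2 T hT
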